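/- All graphs are finite and simple. A separator of a graph $K$ is a set $S\subseteq V(K)$ such that $K-S$ is disconnected (a $k$-separator if $|S|=k$); a block is a connected graph without a 1-separator, and a block of a graph is an inclusion-wise maximal subgraph that is a block. For a subgraph $H$ of $K$, an $H$-bridge of $K$ is either an edge of $E(K)\setminus E(H)$ with both ends in $H$, or a component of $K-V(H)$ together with all edges (and their ends) joining it to $H$; its attachments are its vertices in $H$, its other vertices are internal, and it is trivial if it is just one edge. For a plane graph $K$ let $C_K$ be the boundary of its outer face; a bridge is outer if it contains an edge of $C_K$. For $c,d$ on $C_K$ let $cC_Kd$ be the clockwise path of $C_K$ from $c$ to $d$. An $s$-$\alpha$-$t$-path of $K$ is a Tutte path from $s$ to $t$ through the edge $\alpha$, i.e. a path $P$ from $s$ to $t$ containing $\alpha$ such that every $P$-bridge of $K$ has at most three attachments and every outer $P$-bridge at most two. **Setting.** Let $G$ be a 2-connected plane graph, $\alpha=l_\alpha r_\alpha\in E(C_G)$, $x\in V(C_G)$ and $y\in V(G)$. Let $Q=xC_Gl_\alpha$, and suppose that $r_\alpha\notin Q$, $y\notin Q$ and $y\ne r_\alpha$. Suppose further: * for neither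 $z=x$ nor $z=y$ are there subgraphs $G_L,G_R$ of $G$ with $G_L\cup G_R=G$, $V(G_L)\cap V(G_R)=\{c,d\}$ for some $c\neq d$, $z\in V(G_L)$, $\alpha\in E(G_R)$, $V(G_L)\ne\{z,c,d\}$ and $V(G_R)\neq\{c,d\}$; * there are no 2-separator $\{c,d\}$ of $G$ and $\{c,d\}$-bridge $J$ of $G$ such that $J$ has an internal vertex on $C_G$ and contains none of $x,y,\alpha$. Let $H=G-V(Q)$, let $B_1$ be the block of $H$ containing the edge incident to $r_\alpha$ that is not in $C_G$ and shares a face with $\alpha$, and let $K$ be the minimal chain of blocks $B_1,\dots,B_l$ of $H$ that contains $B_1$ and $y$ (so $y\in B_l$). Let $v_i$ be the common vertex of $B_i$ and $B_{i+1}$ for $1\le i<l$, and let $v_0=r_\alpha$, $v_l=y$. For each $i$ let $\alpha_i\in E(C_{B_i})$ be arbitrary. **Maximal 2-separators.** Fix $i$ and write $B=B_i$. For a 2-separator $\{c,d\}\subseteq V(C_B)$ of $B$ let $B_{cd}^+$ be the $\{c,d\}$-bridge of $B$ that contains $cC_Bd$. The boundary points of $B$ are $v_{i-1}$, the two ends of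 $\alpha_i$, and $v_i$ if $v_i\in C_B$. If $v_i\notin C_B$ (which is only possible for $i=l$), consider the 2-separators $\{a,b\}\subseteq V(C_B)$ of $B$ such that $B_{ab}^+$ contains $v_i$ and $aC_Bb$ is contained in one of the paths $v_{i-1}C_B\alpha_i$, $\alpha_i$, $\alpha_iC_Bv_{i-1}$ into which $v_{i-1}$ and the ends of $\alpha_i$ divide $C_B$; if there are any, take one for which $aC_Bb$ has minimal length, and add as boundary points all attachments of the $aC_Bb$-bridge of $B$ that contains $v_i$ (these do not depend on the choice). The boundary parts of $B$ are the inclusion-wise maximal paths of $C_B$ without a boundary point as inner vertex. A 2-separator $\{c,d\}$ of $B$ with $cC_Bd$ contained in a boundary part $Z$ is maximal if there is no 2-separator $\{c',d'\}$ of $B$ with $cC_Bd\subsetneq c'C_Bd'\subseteq Z$. **The graph $\eta(B_i)$.** If $\alpha_i=v_{i-1}v_i$, let $\eta(B_i)$ be the graph consisting of $\alpha_i$ and its ends. Otherwise $\eta(B_i)$ is obtained from $B=B_i$ by splitting off $B_{cd}^+$ for all maximal 2-separators $\{c,d\}$ of $B$, i.e. by deleting all internal vertices of $B_{cd}^+$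 and adding the edge $cd$ if it does not already exist. Here $\eta(B_i)$ is embedded such that $cd$ is drawn where $cC_Bd$ was drawn, so that $C_{\eta(B_i)}$ arises from $C_B$ by replacing every such path $cC_Bd$ by the edge $cd$ (if $cd$ is itself the edge of $C_B$ outside of $cC_Bd$, it stays where it is and $\eta(B_i)$ is just the remaining plane subgraph of $B$). **Lemma.** For every $1\le i\le l$, the graph $\eta(B_i)$ is a block. Moreover, for every $v_{i-1}$-$\alpha_i$-$v_i$-path $P_i^\eta$ of $\eta(B_i)$ with $P_i^\eta\ne\alpha_i$, every outer $P_i^\eta$-bridge of $\eta(B_i)$ is trivial. -/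

import Mathlib

open SimpleGraph

/-! ### Separators, blocks, bridges

All graphs are simple graphs whose vertices lie in a fixed type `V`.  A graph with vertex set
contained in `V` is a term of type `A.Subgraph` for some ambient simple graph `A` on `V`. -/

section Graphs

variable {V : Type*} {A : SimpleGraph V}

/-- `S` is a set of vertices of `K` such that `K - S` is disconnected. -/
def IsSeparator (K : A.Subgraph) (S : Set V) : Prop :=
  S ⊆ K.verts ∧ ¬ (K.deleteVerts S).coe.Preconnected

/-- `{c, d}` is a 2-separator of `K`. -/
def IsTwoSeparator (K : A.Subgraph) (c d : V) : Prop :=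
  c ≠ d ∧ IsSeparator K {c, d}

/-- A block: a connected graph without a 1-separator. -/
def IsBlock (K : A.Subgraph) : Prop :=
  K.Connected ∧ ∀ v, ¬ IsSeparator K {v}

/-- `K` is 2-connected: it has more than two vertices and is a block. -/
def IsTwoConnected (K : A.Subgraph) : Prop :=
  2 < K.verts.ncard ∧ IsBlock K

/-- `K` is a block of `H`: an inclusion-wise maximal subgraph of `H` that is a block. -/
def IsBlockOf (K H : A.Subgraph) : Prop :=
  Maximal (fun L : A.Subgraph => L ≤ H ∧ IsBlock L) K

/-- `D` is the vertex set of a component of `K`. -/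
def IsComponentSet (K : A.Subgraph) (D : Set V) : Prop :=
  ∃ v ∈ K.verts, D = {u | K.spanningCoe.Reachable v u}

/-- The graph formed by the vertices in `D`, all edges of `K` with an end in `D`, and the ends of
these edges. -/
def incidentSubgraph (K : A.Subgraph) (D : Set V) : A.Subgraph where
  verts := {v | v ∈ K.verts ∧ (v ∈ D ∨ ∃ u ∈ D, K.Adj u v)}
  Adj u v := K.Adj u v ∧ (u ∈ D ∨ v ∈ D)
  adj_sub h := K.adj_sub h.1
  edge_vert := by
    rintro u v ⟨h, hu | hv⟩
    · exact ⟨K.edge_vert h, Or.inl hu⟩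
    · exact ⟨K.edge_vert h, Or.inr ⟨v, hv, h.symm⟩⟩
  symm := ⟨fun _ _ h => ⟨h.1.symm, h.2.symm⟩⟩

/-- `J` is an `H`-bridge of `K`: either an edge of `K` with both ends in `H` that is not in `H`,
or a component of `K - H` together with all edges (and their ends) joining it to `H`. -/
def IsBridgeOf (K H J : A.Subgraph) : Prop :=
  (∃ (u v : V) (h : K.Adj u v), u ∈ H.verts ∧ v ∈ H.verts ∧ ¬ H.Adj u v ∧
    J = A.subgraphOfAdj (K.adj_sub h)) ∨
  ∃ D : Set V, IsComponentSet (K.deleteVerts H.verts) D ∧ J = incidentSubgraph K D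

/-- A bridge is trivial if it is just one edge. -/
def IsTrivialBridge (J : A.Subgraph) : Prop := ∃ e, J.edgeSet = {e}

/-- The attachments of an `H`-bridge `J`. -/
def attachments (H J : A.Subgraph) : Set V := J.verts ∩ H.verts

/-- A bridge is outer, with respect to the edge set `C` of the boundary of the outer face, if it
contains an edge of `C`. -/
def IsOuterBridge (C : Set (Sym2 V)) (J : A.Subgraph) : Prop := (J.edgeSet ∩ C).Nonempty

/-- `p` is an `s`-`α`-`t`-path of the graph `K` whose outer face is bounded by the edges in `C`:
a Tutte path of `K` from `s` to `t` that contains the edge `α`. -/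
def IsTuttePathThrough (K : A.Subgraph) (C : Set (Sym2 V)) (α : Sym2 V) {s t : V}
    (p : A.Walk s t) : Prop :=
  p.IsPath ∧ p.toSubgraph ≤ K ∧ α ∈ p.edges ∧
  ∀ J, IsBridgeOf K p.toSubgraph J →
    (attachments p.toSubgraph J).ncard ≤ 3 ∧
    (IsOuterBridge C J → (attachments p.toSubgraph J).ncard ≤ 2)

/-- The graph with vertex set `S` and no edges. -/
def edgelessOn (A : SimpleGraph V) (S : Set V) : A.Subgraph where
  verts := S
  Adj _ _ := False
  adj_sub h := h.elim
  edge_vert h := h.elim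
  symm := ⟨fun _ _ h => h⟩

/-- `v` is an inner vertex of the path `p`. -/
def IsInner {a b : V} (p : A.Walk a b) (v : V) : Prop := v ∈ p.support ∧ v ≠ a ∧ v ≠ b

end Graphs

/-! ### Plane graphs -/

section Plane

variable {V : Type*} {G : SimpleGraph V}

/-- Given the clockwise rotation of the darts (oriented edges) around each vertex, the permutation
that sends a dart `u → v` to the dart that follows it on the boundary of the face on its left. -/
def facePerm (rot : Equiv.Perm G.Dart) : Equiv.Perm G.Dart :=
  (Function.Involutive.toPerm Dart.symm Dart.symm_involutive).trans rot

/-- The faces: the orbits of the face permutation. -/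
abbrev FaceOf (rot : Equiv.Perm G.Dart) : Type _ :=
  Quotient (Equiv.Perm.SameCycle.setoid (facePerm rot))

/-- A plane embedding of a finite connected graph `G` with at least one edge, given by the
clockwise cyclic order of the edges around each vertex, such that Euler's formula
`|V| - |E| + |F| = 2` holds, and by the choice of the outer face. -/
structure PlaneEmbedding (G : SimpleGraph V) where
  rot : Equiv.Perm G.Dart
  rot_fst : ∀ d, (rot d).fst = d.fst
  rot_cyclic : ∀ d d', d.fst = d'.fst → rot.SameCycle d d'
  euler : Nat.card V + Nat.card (FaceOf rot) = Nat.card G.edgeSet + 2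
  outer : FaceOf rot

namespace PlaneEmbedding

variable (E : PlaneEmbedding G)

/-- The face on the left of a dart. -/
def face (d : G.Dart) : FaceOf E.rot := Quotient.mk _ d

/-- The face `f` of `G` is part of the outer face of the plane subgraph `B` of `G`: it can be
reached from the outer face of `G` by crossing only edges that are not in `B`. -/
def InOuterFace (B : G.Subgraph) (f : FaceOf E.rot) : Prop :=
  Relation.ReflTransGen
    (fun f₁ f₂ => ∃ d : G.Dart, d.edge ∉ B.edgeSet ∧ E.face d = f₁ ∧ E.face d.symm = f₂)
    E.outer f

/-- The dart `d` belongs to `B` and has the outer face of `B` on its left, i.e. it is an edge of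
`C_B` in clockwise direction. -/
def IsOuterDart (B : G.Subgraph) (d : G.Dart) : Prop :=
  d.edge ∈ B.edgeSet ∧ E.InOuterFace B (E.face d)

/-- The edge set of `C_B`, the boundary of the outer face of the plane subgraph `B` of `G`. -/
def outerEdges (B : G.Subgraph) : Set (Sym2 V) := {e | ∃ d, E.IsOuterDart B d ∧ d.edge = e}

/-- The vertex set of `C_B`. -/
def outerVerts (B : G.Subgraph) : Set V := {v | ∃ e ∈ E.outerEdges B, v ∈ e}

/-- `p` is the clockwise path `c C_B d` of `C_B` from `c` to `d`. -/
def IsArc (B : G.Subgraph) {c d : V} (p : G.Walk c d) : Prop :=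
  p.IsPath ∧ ∀ f ∈ p.darts, E.IsOuterDart B f

/-! ### Boundary points, boundary parts and maximal 2-separators

`B` is a plane block with prescribed vertices `s`, `t` and a prescribed edge `α` of `C_B`. -/

/-- `J` is `B_{cd}^+`, the `{c, d}`-bridge of `B` that contains the path `p = c C_B d`. -/
def IsPlusBridge (B : G.Subgraph) {c d : V} (p : G.Walk c d) (J : G.Subgraph) : Prop :=
  IsBridgeOf B (edgelessOn G {c, d}) J ∧ p.toSubgraph ≤ J

/-- `{c, d}` is a 2-separator of `B` with `p = c C_B d` such that `B_{cd}^+` contains `t` and such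
that `p` is contained in one of the paths `s C_B α`, `α`, `α C_B s`.  (These are the paths into
which `s` and the ends of `α` divide `C_B`, so the latter means that neither `s` nor an end of `α`
is an inner vertex of `p`.) -/
def EnclosesTarget (B : G.Subgraph) (s t : V) (α : Sym2 V) {c d : V} (p : G.Walk c d) : Prop :=
  IsTwoSeparator B c d ∧ E.IsArc B p ∧ (∃ J, IsPlusBridge B p J ∧ t ∈ J.verts) ∧
  ∀ v, IsInner p v → v ≠ s ∧ v ∉ α

/-- The vertices `w_1, …, w_p`: the attachments of the `w_1 C_B w_p`-bridge of `B` that contains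
`t`, where `w_1 C_B w_p` has minimal length among all paths that satisfy `EnclosesTarget`.  There
are none if no path satisfies `EnclosesTarget`. -/
def enclosingPoints (B : G.Subgraph) (s t : V) (α : Sym2 V) : Set V :=
  {w | ∃ (c d : V) (p : G.Walk c d), E.EnclosesTarget B s t α p ∧
    (∀ (c' d' : V) (p' : G.Walk c' d'), E.EnclosesTarget B s t α p' → p.length ≤ p'.length) ∧
    ∃ J, IsBridgeOf B p.toSubgraph J ∧ t ∈ J.verts ∧ w ∈ attachments p.toSubgraph J}

open Classical in
/-- The boundary points of `B`: `s`, the ends of `α`, and `t` if `t` lies on `C_B`, but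
`w_1, …, w_p` (if they exist) if `t` does not lie on `C_B`. -/
def boundaryPoints (B : G.Subgraph) (s t : V) (α : Sym2 V) : Set V :=
  {v | v = s ∨ v ∈ α} ∪ (if t ∈ E.outerVerts B then {t} else E.enclosingPoints B s t α)

/-- The boundary parts of `B`: the inclusion-wise maximal paths of `C_B` that do not contain a
boundary point as inner vertex. -/
def IsBoundaryPart (B : G.Subgraph) (s t : V) (α : Sym2 V) (Z : G.Subgraph) : Prop :=
  Maximal (fun Z' : G.Subgraph => ∃ (a b : V) (q : G.Walk a b), E.IsArc B q ∧
    (∀ v, IsInner q v → v ∉ E.boundaryPoints B s t α) ∧ Z' = q.toSubgraph) Z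

/-- `{c, d}` is a maximal 2-separator of `B`, with `p = c C_B d`: for some boundary part `Z`, it
is a 2-separator with `c C_B d ⊆ Z`, and there is no 2-separator `{c', d'}` of `B` with
`c C_B d ⊂ c' C_B d' ⊆ Z`. -/
def IsMaximalSeparator (B : G.Subgraph) (s t : V) (α : Sym2 V) {c d : V} (p : G.Walk c d) :
    Prop :=
  IsTwoSeparator B c d ∧ E.IsArc B p ∧
  ∃ Z, E.IsBoundaryPart B s t α Z ∧ p.toSubgraph ≤ Z ∧
    ∀ (c' d' : V) (p' : G.Walk c' d'), IsTwoSeparator B c' d' → E.IsArc B p' →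
      p'.toSubgraph ≤ Z → ¬ p.toSubgraph < p'.toSubgraph

/-! ### The graph `η(B)` -/

/-- The vertices deleted by splitting off `B_{cd}^+` for all maximal 2-separators `{c, d}`: the
internal vertices of these bridges. -/
def splitVerts (B : G.Subgraph) (s t : V) (α : Sym2 V) : Set V :=
  {v | ∃ (c d : V) (p : G.Walk c d) (J : G.Subgraph), E.IsMaximalSeparator B s t α p ∧
    IsPlusBridge B p J ∧ v ∈ J.verts ∧ v ≠ c ∧ v ≠ d}

/-- The edges `cd` for the maximal 2-separators `{c, d}`. -/
def splitEdges (B : G.Subgraph) (s t : V) (α : Sym2 V) : Set (Sym2 V) :=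
  {e | ∃ (c d : V) (p : G.Walk c d), E.IsMaximalSeparator B s t α p ∧ e = s(c, d)}

/-- The graph obtained from `B` by splitting off `B_{cd}^+` for every maximal 2-separator
`{c, d}`: delete the internal vertices of `B_{cd}^+` and add the edge `cd` if it does not exist. -/
def splitGraph (B : G.Subgraph) (s t : V) (α : Sym2 V) : (⊤ : SimpleGraph V).Subgraph where
  verts := B.verts \ E.splitVerts B s t α
  Adj u v := u ∈ B.verts \ E.splitVerts B s t α ∧ v ∈ B.verts \ E.splitVerts B s t α ∧ u ≠ v ∧
    (B.Adj u v ∨ s(u, v) ∈ E.splitEdges B s t α)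
  adj_sub h := h.2.2.1
  edge_vert h := h.1
  symm := ⟨fun u v h => ⟨h.2.1, h.1, h.2.2.1.symm, by
    rw [Sym2.eq_swap]; exact h.2.2.2.imp Subgraph.Adj.symm id⟩⟩

/-- The graph with vertices `s` and `t` and the edge `st`. -/
def edgeGraph (s t : V) : (⊤ : SimpleGraph V).Subgraph where
  verts := {s, t}
  Adj u v := u ≠ v ∧ s(u, v) = s(s, t)
  adj_sub h := h.1
  edge_vert := by
    rintro u v ⟨-, h⟩
    have : u ∈ s(s, t) := h ▸ Sym2.mem_mk_left u v
    simpa using this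
  symm := ⟨fun u v h => ⟨h.1.symm, by rw [Sym2.eq_swap]; exact h.2⟩⟩

open Classical in
/-- `η(B)`. -/
noncomputable def eta (B : G.Subgraph) (s t : V) (α : Sym2 V) : (⊤ : SimpleGraph V).Subgraph :=
  if α = s(s, t) then edgeGraph s t else E.splitGraph B s t α

open Classical in
/-- The edge set of `C_{η(B)}`.  After splitting off `B_{cd}^+`, the edge `cd` is drawn where the
path `c C_B d` was drawn, so `C_{η(B)}` is obtained from `C_B` by replacing each path `c C_B d` by
the edge `cd`.  The only exception is that `cd` is itself the remaining edge of `C_B` outside of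
`c C_B d`; it then stays where it is, nothing is added, and `η(B)` is a plane subgraph of `B`. -/
noncomputable def etaOuterEdges (B : G.Subgraph) (s t : V) (α : Sym2 V) : Set (Sym2 V) :=
  if α = s(s, t) then {α}
  else if ∃ (c d : V) (p : G.Walk c d), E.IsMaximalSeparator B s t α p ∧
      s(c, d) ∈ E.outerEdges B ∧ s(c, d) ∉ p.edges then
    E.outerEdges (B.deleteVerts (E.splitVerts B s t α))
  else
    {e | e ∈ E.outerEdges B ∧
      ∀ (c d : V) (p : G.Walk c d), E.IsMaximalSeparator B s t α p → e ∉ p.edges} ∪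
    E.splitEdges B s t α

/-! ### The setting -/

/-- `G` is decomposable into subgraphs `L` and `R` with `z ∈ V(L)` and `α ∈ E(R)`. -/
def IsDecomposable (G : SimpleGraph V) (z : V) (α : Sym2 V) : Prop :=
  ∃ (L R : G.Subgraph) (c d : V), c ≠ d ∧ L ⊔ R = ⊤ ∧ L.verts ∩ R.verts = {c, d} ∧
    z ∈ L.verts ∧ α ∈ R.edgeSet ∧ L.verts ≠ {z, c, d} ∧ R.verts ≠ {c, d}

/-- There are a 2-separator `{c, d}` of `G` and a `{c, d}`-bridge `J` of `G` with an internal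
vertex on `C_G` such that none of `x`, `y`, `α` is in `J`. -/
def HasIsolatedBridge (x y : V) (α : Sym2 V) : Prop :=
  ∃ (c d : V) (J : G.Subgraph), IsTwoSeparator (⊤ : G.Subgraph) c d ∧
    IsBridgeOf (⊤ : G.Subgraph) (edgelessOn G {c, d}) J ∧
    (∃ v ∈ J.verts, v ≠ c ∧ v ≠ d ∧ v ∈ E.outerVerts ⊤) ∧
    x ∉ J.verts ∧ y ∉ J.verts ∧ α ∉ J.edgeSet

/-- Two edges share a face. -/
def ShareFace (e e' : Sym2 V) : Prop :=
  ∃ d d' : G.Dart, d.edge = e ∧ d'.edge = e' ∧ E.face d = E.face d'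

/-- `B_1, …, B_l` (indexed from `0`, with `l = k + 1`) are the blocks, in order, of the minimal
chain of blocks `K` of `H` that contains `B_1` and `y`, where `B_1` is the block of `H` that
contains the edge incident to `r` that is not in `C_G` and shares a face with `α`.  Moreover
`v_0 = r`, `v_l = y` and `v_i` is the intersection of `B_i` and `B_{i+1}`. -/
structure IsBlockChain (H : G.Subgraph) (r y : V) (α : Sym2 V) {k : ℕ}
    (B : Fin (k + 1) → G.Subgraph) (v : Fin (k + 2) → V) : Prop where
  isBlockOf : ∀ i, IsBlockOf (B i) H
  injective : Function.Injective B
  blocks_union : ∀ J, IsBlockOf J (⨆ i, B i) ↔ ∃ i, J = B i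
  inter : ∀ i : Fin k, (B i.castSucc).verts ∩ (B i.succ).verts = {v i.succ.castSucc}
  distinct : Function.Injective fun i : Fin k => v i.succ.castSucc
  separators : ∀ z, IsSeparator (⨆ i, B i) {z} ↔ ∃ i : Fin k, z = v i.succ.castSucc
  first : ∃ e ∈ (B 0).edgeSet, r ∈ e ∧ e ∉ E.outerEdges ⊤ ∧ E.ShareFace e α
  last : y ∈ (B (Fin.last k)).verts
  minimal : ∀ i : Fin k, y ∉ (B i.castSucc).verts
  v_zero : v 0 = r
  v_last : v (Fin.last (k + 1)) = y

end PlaneEmbedding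

end Plane

/-! ### Cycle space modulo 2 and a discrete Jordan curve theorem -/

section Colouring

variable {V : Type*} {G : SimpleGraph V}

namespace PlaneEmbedding

variable (E : PlaneEmbedding G)

/-! Number the vertices of `C_B` clockwise as `u 0, …, u (n - 1)` such that `α` joins `u (n - 1)` to
`u 0` (`IsFrame`). Since the ends of `α` are boundary points, the path of a maximal 2-separator is
an interval `u i, …, u j` or just `α`, and splitting off becomes a question about intervals. The
topological input is a discrete Jordan curve theorem, `exists_colouring`: Euler's formula and a
dimension count over `ZMod 2` show that every closed walk is the boundary of a set of faces. It
yields that `C_B` is a single cycle, that walks of `B` with interlacing ends on `C_B` meet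
(`crossing`), and that nothing inside `C_B` reaches the outer face of `G` (`not_onOuterFace`). By
`crossing`, the bridge split off at `u i, …, u j` meets `C_B` only in this interval
(`lt_of_linked`).

Block property. If the ends of all maximal separators survive, a walk of `B` becomes a walk of
`η(B)` by replacing each excursion into a split-off bridge with the new edge, so connectivity after
deleting any set of vertices is inherited (`linked_splitGraph`). An end is lost only if two maximal
separators cross. Then the union of their intervals is not cut off by a 2-separator, the two bridges
cover everything but the ends of `α`, and `η(B)` is the single edge `α` (`ends_notMem_or`).

Outer bridges. Suppose that a nontrivial outer bridge of `P` has an internal vertex `u j` and at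
most two attachments. The nearest vertices `u a`, `u b` of `P` on both sides of `u j` along `C_B`
are attachments, hence all of them. As `P ≠ α` has a third vertex, `{u a, u b}` separates `B`, and
no boundary point lies strictly between: it would be on `P`, or be joined to the end of `P` avoiding
`u a` and `u b`. So some maximal separator covers the interval and `u j` has been split off, a
contradiction (`two_lt_ncard_attachments`).

This needs the outer bridge to have an internal vertex on `C_B`, which may fail only if all of `C_B`
except `α` is cut off by one maximal separator, whose new edge is `α`. Then the block is the last
one and `y` is not on its boundary. The interior of `C_B` has no neighbours outside `B`
(`adj_of_interior`), so the rest of `B` would decompose `G` unless it is `{y, u 0, u (n - 1)}`. All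
three vertices are on `P`, which leaves only trivial bridges. -/

theorem face_symm (d : G.Dart) : E.face d.symm = E.face (E.rot d) := by
  refine Quotient.sound (s := Equiv.Perm.SameCycle.setoid (facePerm E.rot)) ⟨1, ?_⟩
  simp [facePerm]

/-- A colouring of the faces that does not change across the edges at `v` is constant around `v`. -/
theorem colour_eq_of_fst_eq {β : Type*} (f : FaceOf E.rot → β) {v : V}
    (h : ∀ d : G.Dart, d.fst = v → f (E.face d) = f (E.face d.symm)) {d d' : G.Dart}
    (hd : d.fst = v) (hd' : d'.fst = v) [Finite V] : f (E.face d) = f (E.face d') := by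
  have : Finite G.Dart := by
    classical
    have := Fintype.ofFinite V
    infer_instance
  obtain ⟨k, rfl⟩ := (E.rot_cyclic d d' (hd.trans hd'.symm)).exists_nat_pow_eq
  have key : ∀ k : ℕ, ((E.rot ^ k) d).fst = v ∧ f (E.face d) = f (E.face ((E.rot ^ k) d)) := by
    intro k
    induction k with
    | zero => simp [hd]
    | succ k ih =>
      rw [pow_succ', Equiv.Perm.mul_apply, E.rot_fst, ← E.face_symm, ← h _ ih.1]
      exact ih
  exact (key k).2

end PlaneEmbedding

open Classical in
/-- The boundary of an edge set modulo 2. -/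
noncomputable def vertexBoundary [Fintype G.Dart] :
    (G.edgeSet → ZMod 2) →ₗ[ZMod 2] (V → ZMod 2) where
  toFun z v := ∑ d : G.Dart with d.fst = v, z ⟨d.edge, d.edge_mem⟩
  map_add' z z' := by ext v; simp [Finset.sum_add_distrib]
  map_smul' c z := by ext v; simp [Finset.mul_sum]

theorem pi_add_self (g : V → ZMod 2) : g + g = 0 := by
  ext v
  exact CharTwo.add_self_eq_zero _

theorem vertexBoundary_walk [Fintype G.Dart] [DecidableEq V] {u v : V} (w : G.Walk u v) :
    vertexBoundary (fun e : G.edgeSet => (w.edges.count (e : Sym2 V) : ZMod 2)) =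
      Pi.single u 1 + Pi.single v 1 := by
  induction w with
  | nil =>
    have : (fun e : G.edgeSet => ((([] : List (Sym2 V)).count (e : Sym2 V) : ℕ) : ZMod 2))
      = 0 := by ext e; simp
    simp only [Walk.edges_nil]
    rw [this, map_zero]
    exact (pi_add_self _).symm
  | @cons a b c h p ih =>
    have h1 : (fun e : G.edgeSet => (((Walk.cons h p).edges.count (e : Sym2 V) : ℕ) : ZMod 2)) =
        (fun e : G.edgeSet => ((p.edges.count (e : Sym2 V) : ℕ) : ZMod 2)) +
        (fun e : G.edgeSet => if s(a, b) = (e : Sym2 V) then 1 else 0) := by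
      ext e
      simp [List.count_cons]
    have h2 : vertexBoundary (fun e : G.edgeSet => if s(a, b) = (e : Sym2 V) then 1 else 0) =
        Pi.single a 1 + Pi.single b 1 := by
      ext x
      have hne := h.ne
      set d₀ : G.Dart := ⟨(a, b), h⟩
      have h3 : ∀ d : G.Dart, s(a, b) = d.edge ↔ d = d₀ ∨ d = d₀.symm := by
        intro d
        rw [← dart_edge_eq_iff]
        exact eq_comm
      have h4 : d₀ ≠ d₀.symm := (Dart.symm_ne d₀).symm
      simp only [vertexBoundary, LinearMap.coe_mk, AddHom.coe_mk, h3, Finset.sum_filter,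
        Pi.add_apply]
      have h5 : ∀ d : G.Dart, (if d.fst = x then if d = d₀ ∨ d = d₀.symm then (1 : ZMod 2) else 0
          else 0) = (if d = d₀ then if x = a then 1 else 0 else 0) +
          (if d = d₀.symm then if x = b then 1 else 0 else 0) := by
        intro d
        by_cases hd : d = d₀
        · subst hd
          simp only [if_pos, if_neg h4, true_or, add_zero, d₀, @eq_comm _ x]
        · by_cases hd' : d = d₀.symm
          · subst hd'
            simp only [if_pos, if_neg h4.symm, or_true, zero_add, @eq_comm _ x]
            rfl
          · simp [hd, hd']
      rw [Finset.sum_congr rfl fun d _ => h5 d, Finset.sum_add_distrib, Finset.sum_ite_eq',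
        Finset.sum_ite_eq']
      simp [Pi.single_apply]
    rw [h1, map_add, ih, h2]
    have : (Pi.single b 1 : V → ZMod 2) + Pi.single b 1 = 0 := pi_add_self _
    linear_combination this

namespace PlaneEmbedding

variable (E : PlaneEmbedding G)

open Classical in
/-- The boundary of a set of faces modulo 2. -/
noncomputable def faceBoundary [Fintype G.Dart] :
    (FaceOf E.rot → ZMod 2) →ₗ[ZMod 2] (G.edgeSet → ZMod 2) where
  toFun f e := ∑ d : G.Dart with d.edge = (e : Sym2 V), f (E.face d)
  map_add' z z' := by ext v; simp [Finset.sum_add_distrib]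
  map_smul' c z := by ext v; simp [Finset.mul_sum]

theorem faceBoundary_apply [Fintype G.Dart] (f : FaceOf E.rot → ZMod 2) (d : G.Dart) :
    E.faceBoundary f ⟨d.edge, d.edge_mem⟩ = f (E.face d) + f (E.face d.symm) := by
  classical
  have h : (Finset.univ.filter fun d' : G.Dart => d'.edge = d.edge) = {d, d.symm} := by
    ext d'
    simp [dart_edge_eq_iff]
  simp only [faceBoundary, LinearMap.coe_mk, AddHom.coe_mk, h]
  rw [Finset.sum_pair (Dart.symm_ne d).symm]

/-- The rotation permutes the darts at `v`, and the right face of a dart is the left face of the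
next one, so every colour at `v` is counted twice. -/
theorem vertexBoundary_faceBoundary [Fintype G.Dart] (f : FaceOf E.rot → ZMod 2) :
    vertexBoundary (E.faceBoundary f) = 0 := by
  classical
  ext v
  simp only [vertexBoundary, LinearMap.coe_mk, AddHom.coe_mk, faceBoundary_apply, E.face_symm,
    Finset.sum_add_distrib, Pi.zero_apply]
  have : ∑ d : G.Dart with d.fst = v, f (E.face (E.rot d)) =
      ∑ d : G.Dart with d.fst = v, f (E.face d) := by
    refine Finset.sum_equiv E.rot ?_ ?_
    · intro d; simp [E.rot_fst]
    · intros; rfl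
  rw [this]
  exact CharTwo.add_self_eq_zero _

theorem colour_const [Finite V] (hG : G.Preconnected) (f : FaceOf E.rot → ZMod 2)
    (h : ∀ d : G.Dart, f (E.face d) = f (E.face d.symm)) (d d' : G.Dart) :
    f (E.face d) = f (E.face d') := by
  obtain ⟨w⟩ := hG d.fst d'.fst
  have key : ∀ {a b : V} (w : G.Walk a b), ∀ d d' : G.Dart, d.fst = a → d'.fst = b →
      f (E.face d) = f (E.face d') := by
    intro a b w
    induction w with
    | nil => exact fun d d' hd hd' => E.colour_eq_of_fst_eq f (fun d _ => h d) hd hd'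
    | @cons a b c hab p ih =>
      intro d d' hd hd'
      have h1 := E.colour_eq_of_fst_eq f (fun d _ => h d) hd (d' := ⟨(a, b), hab⟩) rfl
      rw [h1, h, ih (Dart.symm ⟨(a, b), hab⟩) d' rfl hd']
  exact key w d d' rfl rfl

/-- A discrete Jordan curve theorem: for every closed walk, the faces can be coloured such that
the colour changes exactly at the edges that the walk traverses an odd number of times. -/
theorem exists_colouring [Finite V] (hG : G.Preconnected) {v : V} (w : G.Walk v v) [DecidableEq V] :
    ∃ f : FaceOf E.rot → ZMod 2, f E.outer = 0 ∧
      ∀ d : G.Dart, f (E.face d) + f (E.face d.symm) = (w.edges.count d.edge : ZMod 2) := by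
  classical
  have := Fintype.ofFinite V
  have : Finite (FaceOf E.rot) := Quotient.finite _
  have := Fintype.ofFinite (FaceOf E.rot)
  have := Fintype.ofFinite G.edgeSet
  have hle : LinearMap.range E.faceBoundary ≤ LinearMap.ker (vertexBoundary (G := G)) := by
    rintro _ ⟨f, rfl⟩
    exact E.vertexBoundary_faceBoundary f
  -- By Euler's formula it suffices to bound this kernel by 1 and the rank of `vertexBoundary` from
  -- below by `|V| - 1`; then the range of `faceBoundary` is at least as large as the cycle space.
  -- The kernel consists of constant colourings because `G` is connected.
  have h1 : Module.finrank (ZMod 2) (LinearMap.ker E.faceBoundary) ≤ 1 := by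
    have : LinearMap.ker E.faceBoundary ≤ Submodule.span (ZMod 2) {fun _ => 1} := by
      intro f hf
      have hf' : ∀ d : G.Dart, f (E.face d) = f (E.face d.symm) := by
        intro d
        have := E.faceBoundary_apply f d
        rw [LinearMap.mem_ker.1 hf] at this
        exact CharTwo.add_eq_zero.1 this.symm
      obtain ⟨d₀, -⟩ := Quotient.exists_rep E.outer
      refine Submodule.mem_span_singleton.2 ⟨f (E.face d₀), ?_⟩
      ext F
      obtain ⟨d, rfl⟩ := Quotient.exists_rep F
      simpa using! E.colour_const hG f hf' d₀ d
    exact (Submodule.finrank_mono this).trans ((finrank_span_le_card _).trans (by simp))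
  have h2 : Nat.card V ≤ Module.finrank (ZMod 2) (LinearMap.range (vertexBoundary (G := G))) + 1 := by
    -- A path from `u` to `v` has boundary `u + v`, so the single vector at `v` is all that may be
    -- missing from the range.
    have htop : LinearMap.range (vertexBoundary (G := G)) ⊔
        Submodule.span (ZMod 2) {Pi.single v 1} = ⊤ := by
      rw [eq_top_iff]
      rintro g -
      rw [← Finset.univ_sum_single g]
      refine Submodule.sum_mem _ fun u _ => ?_
      obtain ⟨p⟩ := hG u v
      have : Pi.single u (g u) = g u • ((Pi.single u 1 + Pi.single v 1) + Pi.single v 1) := by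
        rw [add_assoc, pi_add_self (Pi.single v 1 : V → ZMod 2), add_zero,
          ← Pi.single_smul]
        simp
      rw [this]
      refine Submodule.smul_mem _ _ (add_mem (Submodule.mem_sup_left ?_)
        (Submodule.mem_sup_right (Submodule.mem_span_singleton_self _)))
      exact ⟨_, vertexBoundary_walk p⟩
    have h := Submodule.finrank_add_le_finrank_add_finrank
      (LinearMap.range (vertexBoundary (G := G))) (Submodule.span (ZMod 2) {Pi.single v 1})
    rw [htop, finrank_top, Module.finrank_fintype_fun_eq_card] at h
    have h' : Module.finrank (ZMod 2)
        (Submodule.span (ZMod 2) {(Pi.single v 1 : V → ZMod 2)}) ≤ 1 :=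
      (finrank_span_le_card _).trans (by simp)
    rw [Nat.card_eq_fintype_card]
    omega
  have h3 := LinearMap.finrank_range_add_finrank_ker E.faceBoundary
  have h4 := LinearMap.finrank_range_add_finrank_ker (vertexBoundary (G := G))
  rw [Module.finrank_fintype_fun_eq_card, ← Nat.card_eq_fintype_card] at h3 h4
  have h5 := E.euler
  have heq := Submodule.eq_of_le_of_finrank_le hle (by omega)
  have hw : (fun e : G.edgeSet => (w.edges.count (e : Sym2 V) : ZMod 2)) ∈
      LinearMap.range E.faceBoundary := by
    rw [heq, LinearMap.mem_ker, ← pi_add_self (Pi.single v 1 : V → ZMod 2),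
      ← vertexBoundary_walk w]
  obtain ⟨f, hf⟩ := hw
  -- Adding a constant normalises the outer face to 0 without changing the boundary.
  refine ⟨fun F => f F + f E.outer, CharTwo.add_self_eq_zero _, fun d => ?_⟩
  have := E.faceBoundary_apply f d
  rw [hf] at this
  have h0 : f E.outer + f E.outer = 0 := CharTwo.add_self_eq_zero _
  simp only at this ⊢
  rw [this]
  linear_combination h0

end PlaneEmbedding

end Colouring

/-! ### Connectivity after deleting vertices -/

section Linked

variable {V : Type*} {A : SimpleGraph V}

/-- `x` and `y` are joined by a walk of `K` that avoids `S`. -/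
def Linked (K : A.Subgraph) (S : Set V) (x y : V) : Prop :=
  (K.deleteVerts S).spanningCoe.Reachable x y

namespace Linked

variable {K : A.Subgraph} {S T : Set V} {x y z : V}

theorem adj_iff : (K.deleteVerts S).spanningCoe.Adj x y ↔ x ∉ S ∧ y ∉ S ∧ K.Adj x y := by
  simp only [Subgraph.spanningCoe_adj, Subgraph.deleteVerts_adj]
  exact ⟨fun h => ⟨h.2.1, h.2.2.2.1, h.2.2.2.2⟩,
    fun h => ⟨K.edge_vert h.2.2, h.1, K.edge_vert h.2.2.symm, h.2.1, h.2.2⟩⟩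

/-- Holds even for `x` in `S` or outside `K`, because the spanning graph keeps such vertices as
isolated ones; this is why later lemmas ask for `x ∉ S` or `x ∈ K.verts`. -/
theorem refl (x : V) : Linked K S x x := Reachable.refl x

theorem symm (h : Linked K S x y) : Linked K S y x := Reachable.symm h

theorem trans (h : Linked K S x y) (h' : Linked K S y z) : Linked K S x z := Reachable.trans h h'

theorem of_adj (h : K.Adj x y) (hx : x ∉ S) (hy : y ∉ S) : Linked K S x y :=
  Adj.reachable (adj_iff.2 ⟨hx, hy, h⟩)

theorem induct {P : V → Prop} (h : Linked K S x y) (h₀ : P x)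
    (hs : ∀ a b, a ∉ S → b ∉ S → K.Adj a b → P a → P b) : P y := by
  obtain ⟨w⟩ := h
  induction w with
  | nil => exact h₀
  | cons hab p ih =>
    obtain ⟨ha, hb, hk⟩ := adj_iff.1 hab
    exact ih (hs _ _ ha hb hk h₀)

theorem mono {L : A.Subgraph} (hKL : K ≤ L) (hST : T ⊆ S) (h : Linked K S x y) :
    Linked L T x y :=
  h.induct (P := fun z => Linked L T x z) (refl x) fun _ _ ha hb hab ih =>
    ih.trans (of_adj (hKL.2 hab) (fun h => ha (hST h)) fun h => hb (hST h))

theorem notMem (h : Linked K S x y) (hx : x ∉ S) : y ∉ S :=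
  h.induct hx fun _ _ _ hb _ _ => hb

theorem mem_verts (h : Linked K S x y) (hx : x ∈ K.verts) : y ∈ K.verts :=
  h.induct hx fun _ _ _ _ hab _ => K.edge_vert hab.symm

theorem exists_adj (h : Linked K S x y) (hne : x ≠ y) : ∃ z, z ∉ S ∧ K.Adj x z := by
  obtain ⟨w⟩ := h
  cases w with
  | nil => exact absurd rfl hne
  | cons hab p => exact ⟨_, (adj_iff.1 hab).2⟩

theorem exists_walk (h : Linked K S x y) (hx : x ∉ S) :
    ∃ p : A.Walk x y, (∀ e ∈ p.edges, e ∈ K.edgeSet) ∧ ∀ z ∈ p.support, z ∉ S ∧ Linked K S x z := by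
  obtain ⟨w⟩ := h
  induction w with
  | nil => exact ⟨Walk.nil, by simp, by simpa using ⟨hx, refl _⟩⟩
  | cons hab p ih =>
    obtain ⟨ha, hb, hk⟩ := adj_iff.1 hab
    obtain ⟨q, hq, hq'⟩ := ih hb
    refine ⟨Walk.cons (K.adj_sub hk) q, ?_, ?_⟩
    · simpa using ⟨hk, hq⟩
    · intro z hz
      rw [Walk.support_cons, List.mem_cons] at hz
      rcases hz with rfl | hz
      · exact ⟨hx, refl _⟩
      · exact ⟨(hq' z hz).1, (of_adj hk ha hb).trans (hq' z hz).2⟩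

end Linked

theorem coe_preconnected_iff (K : A.Subgraph) : K.coe.Preconnected ↔
    ∀ x ∈ K.verts, ∀ y ∈ K.verts, K.spanningCoe.Reachable x y := by
  constructor
  · intro h x hx y hy
    exact (h ⟨x, hx⟩ ⟨y, hy⟩).map ⟨Subtype.val, fun {a b} hab => hab⟩
  · rintro h ⟨x, hx⟩ ⟨y, hy⟩
    obtain ⟨w⟩ := h x hx y hy
    have key : ∀ {x y : V} (w : K.spanningCoe.Walk x y) (hx : x ∈ K.verts) (hy : y ∈ K.verts),
        K.coe.Reachable ⟨x, hx⟩ ⟨y, hy⟩ := by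
      intro x y w
      induction w with
      | nil => exact fun _ _ => Reachable.refl _
      | cons hab p ih =>
        intro hx hy
        have hab' : K.Adj _ _ := hab
        have hb := K.edge_vert hab'.symm
        exact (Adj.reachable (G := K.coe) (u := ⟨_, hx⟩) (v := ⟨_, hb⟩) hab').trans (ih hb hy)
    exact key w hx hy

theorem deleteVerts_coe_preconnected_iff (K : A.Subgraph) (S : Set V) :
    (K.deleteVerts S).coe.Preconnected ↔
      ∀ x ∈ K.verts, x ∉ S → ∀ y ∈ K.verts, y ∉ S → Linked K S x y := by
  rw [coe_preconnected_iff]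
  simp only [Subgraph.deleteVerts_verts, Set.mem_sdiff, and_imp]
  rfl

theorem isSeparator_iff (K : A.Subgraph) (S : Set V) : IsSeparator K S ↔
    S ⊆ K.verts ∧ ∃ x ∈ K.verts, x ∉ S ∧ ∃ y ∈ K.verts, y ∉ S ∧ ¬ Linked K S x y := by
  rw [IsSeparator, deleteVerts_coe_preconnected_iff]
  push Not
  rfl

theorem isBlock_iff (K : A.Subgraph) : IsBlock K ↔ K.verts.Nonempty ∧
    (∀ x ∈ K.verts, ∀ y ∈ K.verts, Linked K ∅ x y) ∧
    ∀ v, ∀ x ∈ K.verts, x ≠ v → ∀ y ∈ K.verts, y ≠ v → Linked K {v} x y := by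
  have h0 : K.Connected ↔ K.verts.Nonempty ∧ ∀ x ∈ K.verts, ∀ y ∈ K.verts, Linked K ∅ x y := by
    rw [Subgraph.connected_iff, Subgraph.preconnected_iff, coe_preconnected_iff, and_comm]
    refine and_congr Iff.rfl (forall₂_congr fun x _ => forall₂_congr fun y _ => ?_)
    rw [Linked, Subgraph.deleteVerts_empty]
  rw [IsBlock, h0, and_assoc]
  refine and_congr Iff.rfl (and_congr_right fun hc => ?_)
  constructor
  · intro h v x hx hxv y hy hyv
    by_cases hv : v ∈ K.verts
    · have := h v
      rw [isSeparator_iff] at this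
      push Not at this
      exact this (by simpa using hv) x hx hxv y hy hyv
    · refine (hc x hx y hy).induct (P := Linked K {v} x) (Linked.refl x) ?_
      intro a b _ _ hab ih
      refine ih.trans (Linked.of_adj hab ?_ ?_)
      · rintro rfl
        exact hv (K.edge_vert hab)
      · rintro rfl
        exact hv (K.edge_vert hab.symm)
  · intro h v hv
    obtain ⟨-, x, hx, hxv, y, hy, hyv, hn⟩ := (isSeparator_iff _ _).1 hv
    exact hn (h v x hx hxv y hy hyv)

end Linked

/-! ### The boundary of the outer face of a block -/

section OuterCycle

variable {V : Type*} {G : SimpleGraph V}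

namespace PlaneEmbedding

variable (E : PlaneEmbedding G) {B : G.Subgraph}

/-- The outer face of `B` is a union of faces of `G` joined across edges outside `B`, where a walk
in `B` forces no colour change. -/
theorem exists_colouring_of_le [Finite V] [DecidableEq V] (hG : G.Preconnected) {v : V}
    (w : G.Walk v v) (hw : ∀ e ∈ w.edges, e ∈ B.edgeSet) :
    ∃ f : FaceOf E.rot → ZMod 2, (∀ F, E.InOuterFace B F → f F = 0) ∧
      ∀ d : G.Dart, f (E.face d) + f (E.face d.symm) = (w.edges.count d.edge : ZMod 2) := by
  obtain ⟨f, h0, hf⟩ := E.exists_colouring hG w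
  refine ⟨f, fun F hF => ?_, hf⟩
  induction hF with
  | refl => exact h0
  | tail _ h ih =>
    obtain ⟨d, hd, rfl, rfl⟩ := h
    have := hf d
    rw [List.count_eq_zero_of_not_mem fun h => hd (hw _ h), ih] at this
    simpa using this

/-- Faces on both sides of an edge outside `B` are in the same face of `B`. -/
theorem inOuterFace_symm {d : G.Dart} (hd : d.edge ∉ B.edgeSet)
    (h : E.InOuterFace B (E.face d)) : E.InOuterFace B (E.face d.symm) :=
  h.tail ⟨d, hd, rfl, rfl⟩

theorem finite_dart [Finite V] : Finite G.Dart := by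
  classical
  have := Fintype.ofFinite V
  infer_instance

/-- The next edge of the boundary of the outer face: it is the first edge of `B` after `d` in the
rotation. -/
theorem exists_next [Finite V] {d : G.Dart} (hd : E.IsOuterDart B d) :
    ∃ k, 0 < k ∧ (∀ m, 0 < m → m < k → ((E.rot ^ m) d.symm).edge ∉ B.edgeSet) ∧
      E.IsOuterDart B ((E.rot ^ k) d.symm) := by
  classical
  have := finite_dart (G := G)
  have hex : ∃ k, 0 < k ∧ ((E.rot ^ k) d.symm).edge ∈ B.edgeSet :=
    ⟨orderOf E.rot, orderOf_pos _, by simpa [pow_orderOf_eq_one] using hd.1⟩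
  refine ⟨Nat.find hex, (Nat.find_spec hex).1, fun m hm hlt h => Nat.find_min hex hlt ⟨hm, h⟩,
    (Nat.find_spec hex).2, ?_⟩
  have key : ∀ m, 0 < m → m ≤ Nat.find hex → E.InOuterFace B (E.face ((E.rot ^ m) d.symm)) := by
    intro m hm
    induction m, hm using Nat.le_induction with
    | base =>
      intro _
      have := E.face_symm d.symm
      rw [Dart.symm_symm] at this
      simpa [← this] using hd.2
    | succ m hm ih =>
      intro hle
      rw [pow_succ', Equiv.Perm.mul_apply, ← E.face_symm]
      exact E.inOuterFace_symm (fun h => Nat.find_min hex hle ⟨hm, h⟩) (ih (by omega))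
  exact key _ (Nat.find_spec hex).1 le_rfl

theorem rot_pow_fst (k : ℕ) (d : G.Dart) : ((E.rot ^ k) d).fst = d.fst := by
  induction k with
  | zero => rfl
  | succ k ih => rw [pow_succ', Equiv.Perm.mul_apply, E.rot_fst, ih]

theorem exists_next_fst [Finite V] {d : G.Dart} (hd : E.IsOuterDart B d) :
    ∃ d', E.IsOuterDart B d' ∧ d'.fst = d.snd := by
  obtain ⟨k, -, -, h⟩ := E.exists_next hd
  exact ⟨_, h, E.rot_pow_fst _ _⟩

/-- Two edges of `B` with a common end separate the faces around this end, so that the outer face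
of the block `B` lies on at most one side. -/
theorem not_outer_of_ne [Finite V] (hG : G.Preconnected) (hB : IsBlock B) {d₁ d₂ : G.Dart}
    (h₁ : d₁.edge ∈ B.edgeSet) (h₂ : d₂.edge ∈ B.edgeSet) (hfst : d₁.fst = d₂.fst)
    (hne : d₁ ≠ d₂) :
    ¬ (E.InOuterFace B (E.face d₁) ∧ E.InOuterFace B (E.face d₂)) ∧
    ¬ (E.InOuterFace B (E.face d₁.symm) ∧ E.InOuterFace B (E.face d₂.symm)) ∧
    ¬ (E.InOuterFace B (E.face d₁) ∧ E.InOuterFace B (E.face d₁.symm)) := by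
  classical
  have h₁' : B.Adj d₁.fst d₁.snd := h₁
  have h₂' : B.Adj d₂.fst d₂.snd := h₂
  obtain ⟨-, -, hv⟩ := (isBlock_iff _).1 hB
  have h12 := hv d₁.fst d₁.snd (B.edge_vert h₁'.symm) d₁.adj.ne' d₂.snd (B.edge_vert h₂'.symm)
    (hfst ▸ d₂.adj.ne')
  obtain ⟨p, hp, hps⟩ := h12.exists_walk d₁.adj.ne'
  -- Leave along `d₁`, return along `d₂`, and in between avoid the common vertex, which is possible
  -- in a block. At this vertex the colour then changes at `d₁` and `d₂` only.
  let w : G.Walk d₁.fst d₁.fst := Walk.cons d₁.adj (p.concat (hfst ▸ d₂.adj.symm))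
  have hwe : w.edges = d₁.edge :: (p.edges ++ [d₂.edge]) := by
    simp only [w, Walk.edges_cons, Walk.edges_concat, List.concat_eq_append]
    have h1 : d₁.edge = s(d₁.fst, d₁.snd) := rfl
    have h2 : d₂.edge = s(d₂.fst, d₂.snd) := rfl
    rw [h1, h2, hfst, Sym2.eq_swap (a := d₂.snd)]
  obtain ⟨f, h0, hf⟩ := E.exists_colouring_of_le (B := B) hG w (by
    intro e he
    rw [hwe] at he
    simp only [List.mem_cons, List.mem_append, List.not_mem_nil, or_false] at he
    rcases he with rfl | he | rfl
    exacts [h₁, hp e he, h₂])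
  have hee : ∀ d : G.Dart, d.fst = d₁.fst → ∀ d' : G.Dart, d'.fst = d₁.fst →
      (d'.edge = d.edge ↔ d' = d) := by
    intro d hd d' hd'
    rw [dart_edge_eq_iff]
    refine ⟨fun h => h.resolve_right ?_, Or.inl⟩
    rintro rfl
    exact d.adj.ne' (hd'.trans hd.symm)
  have hc : ∀ d : G.Dart, d.fst = d₁.fst → (w.edges.count d.edge : ZMod 2) =
      if d = d₁ ∨ d = d₂ then 1 else 0 := by
    intro d hd
    rw [hwe]
    have hpc : p.edges.count d.edge = 0 := by
      refine List.count_eq_zero_of_not_mem fun h => ?_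
      have := p.fst_mem_support_of_mem_edges (t := d.fst) (u := d.snd) h
      exact (hps _ this).1 hd
    simp only [List.count_cons, List.count_append, hpc, List.count_nil, beq_iff_eq,
      hee d hd d₁ rfl, hee d hd d₂ hfst.symm]
    by_cases h : d = d₁
    · simp [h, hne.symm]
    · by_cases h' : d = d₂
      · simp [h', hne]
      · simp [h, h', eq_comm (a := d₁), eq_comm (a := d₂)]
  have := finite_dart (G := G)
  -- Turning from `d₁` to the first occurrence of `d₂` crosses no edge of the walk strictly in
  -- between.
  have hrot : f (E.face (E.rot d₁)) = f (E.face d₂) := by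
    have hsc := E.rot_cyclic _ _ hfst
    have hex : ∃ k, 0 < k ∧ (E.rot ^ k) d₁ = d₂ := by
      obtain ⟨k, hk⟩ := hsc.exists_nat_pow_eq
      refine ⟨k, Nat.pos_of_ne_zero ?_, hk⟩
      rintro rfl
      exact hne hk
    have key : ∀ m, 0 < m → m ≤ Nat.find hex → f (E.face (E.rot d₁)) =
        f (E.face ((E.rot ^ m) d₁)) := by
      intro m hm
      induction m, hm using Nat.le_induction with
      | base => simp
      | succ m hm ih =>
        intro hle
        rw [ih (by omega), pow_succ', Equiv.Perm.mul_apply, ← E.face_symm]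
        have h1 := hf ((E.rot ^ m) d₁)
        rw [hc _ (E.rot_pow_fst _ _), if_neg] at h1
        · exact CharTwo.add_eq_zero.1 h1
        · rintro (h | h)
          · obtain ⟨hpos, hk⟩ := Nat.find_spec hex
            refine Nat.find_min hex (m := Nat.find hex - m) (by omega) ⟨by omega, ?_⟩
            calc (E.rot ^ (Nat.find hex - m)) d₁
                = (E.rot ^ (Nat.find hex - m)) ((E.rot ^ m) d₁) := congrArg _ h.symm
              _ = d₂ := by
                rw [← Equiv.Perm.mul_apply, ← pow_add, Nat.sub_add_cancel (by omega), hk]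
          · exact Nat.find_min hex hle ⟨hm, h⟩
    rw [key _ (Nat.find_spec hex).1 le_rfl, (Nat.find_spec hex).2]
  have e1 := hf d₁
  have e2 := hf d₂
  rw [hc _ rfl, if_pos (Or.inl rfl)] at e1
  rw [hc _ hfst.symm, if_pos (Or.inr rfl)] at e2
  rw [E.face_symm, hrot] at e1
  refine ⟨fun ⟨ha, hb⟩ => ?_, fun ⟨ha, hb⟩ => ?_, fun ⟨ha, hb⟩ => ?_⟩
  · simp [h0 _ ha, h0 _ hb] at e1
  · rw [E.face_symm] at ha
    rw [← hrot, h0 _ ha, h0 _ hb] at e2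
    simp at e2
  · rw [E.face_symm] at hb
    rw [← hrot, h0 _ ha, h0 _ hb] at e1
    simp at e1

/-- The boundary of the outer face of a block leaves every vertex at most once, so following it
involves no choice. -/
theorem IsOuterDart.eq_of_fst [Finite V] {E : PlaneEmbedding G} (hG : G.Preconnected)
    (hB : IsBlock B) {d₁ d₂ : G.Dart} (h₁ : E.IsOuterDart B d₁) (h₂ : E.IsOuterDart B d₂)
    (h : d₁.fst = d₂.fst) : d₁ = d₂ := by
  by_contra hne
  exact (E.not_outer_of_ne hG hB h₁.1 h₂.1 h hne).1 ⟨h₁.2, h₂.2⟩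

theorem IsOuterDart.eq_of_snd [Finite V] {E : PlaneEmbedding G} (hG : G.Preconnected)
    (hB : IsBlock B) {d₁ d₂ : G.Dart} (h₁ : E.IsOuterDart B d₁) (h₂ : E.IsOuterDart B d₂)
    (h : d₁.snd = d₂.snd) : d₁ = d₂ := by
  by_contra hne
  refine (E.not_outer_of_ne (B := B) (d₁ := d₁.symm) (d₂ := d₂.symm) hG hB ?_ ?_ h ?_).2.1 ⟨?_, ?_⟩
  · simpa using h₁.1
  · simpa using h₂.1
  · exact fun h => hne (Dart.symm_involutive.injective h)
  · simpa using h₁.2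
  · simpa using h₂.2

/-- Around a vertex where a closed walk passes along the boundary of the outer face of `B`, all
other edges of `B` are inside. -/
theorem colour_eq_one [Finite V] (hG : G.Preconnected) (hB : IsBlock B)
    {f : FaceOf E.rot → ZMod 2} (h0 : ∀ F, E.InOuterFace B F → f F = 0) {i o : G.Dart}
    (hi : E.IsOuterDart B i) (ho : E.IsOuterDart B o) (hio : i.snd = o.fst)
    (hf : ∀ d : G.Dart, d.fst = o.fst → (d.snd = i.fst ∨ d.snd = o.snd) →
      f (E.face d) + f (E.face d.symm) = 1)
    (hf' : ∀ d : G.Dart, d.fst = o.fst → d.snd ≠ i.fst → d.snd ≠ o.snd →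
      f (E.face d) + f (E.face d.symm) = 0)
    {d : G.Dart} (hd : d.edge ∈ B.edgeSet) (hdf : d.fst = o.fst) (hds : d.snd ≠ o.snd) :
    f (E.face d) = 1 := by
  classical
  have := finite_dart (G := G)
  have hext : ∀ {d d' : G.Dart}, d.fst = o.fst → d'.fst = o.fst → d.snd = d'.snd → d = d' :=
    fun h h' h'' => Dart.ext _ _ (Prod.ext (h.trans h'.symm) h'')
  -- Reach `d` by rotating from whichever of the two boundary edges comes last before it. By
  -- minimality of `m` no colour change occurs on the way.
  have hex : ∃ m, ∃ x, (x = i.symm ∨ x = o) ∧ (E.rot ^ m) x = d := by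
    obtain ⟨m, hm⟩ := (E.rot_cyclic o d hdf.symm).exists_nat_pow_eq
    exact ⟨m, o, Or.inr rfl, hm⟩
  obtain ⟨x, hx, hm⟩ := Nat.find_spec hex
  set m := Nat.find hex with hmdef
  have hi1 := hf i.symm hio (Or.inl rfl)
  have ho1 := hf o rfl (Or.inr rfl)
  rw [Dart.symm_symm, h0 _ hi.2, add_zero] at hi1
  rw [h0 _ ho.2, zero_add] at ho1
  have hxf : x.fst = o.fst := by
    rcases hx with rfl | rfl
    exacts [hio, rfl]
  have hbetween : ∀ j, 0 < j → j ≤ m → (E.rot ^ j) x ≠ i.symm ∧ (E.rot ^ j) x ≠ o := by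
    intro j hj hjm
    rw [← not_or]
    intro h
    refine Nat.find_min hex (m := m - j) (by omega) ⟨_, h, ?_⟩
    rw [← Equiv.Perm.mul_apply, ← pow_add, Nat.sub_add_cancel hjm, hm]
  rcases Nat.eq_zero_or_pos m with hm0 | hmpos
  · rw [hm0, pow_zero, Equiv.Perm.one_apply] at hm
    rcases hx with rfl | rfl
    · rw [← hm, hi1]
    · exact absurd (hm ▸ rfl) hds
  have key : ∀ j, 0 < j → j ≤ m → f (E.face ((E.rot ^ j) x)) = f (E.face x.symm) := by
    intro j hj
    induction j, hj using Nat.le_induction with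
    | base =>
      intro _
      rw [pow_one, E.face_symm]
    | succ j hj ih =>
      intro hle
      have hjf : ((E.rot ^ j) x).fst = o.fst := (E.rot_pow_fst _ _).trans hxf
      obtain ⟨hb1, hb2⟩ := hbetween j hj (by omega)
      rw [pow_succ', Equiv.Perm.mul_apply, ← E.face_symm, ← ih (by omega)]
      refine (CharTwo.add_eq_zero.1 (hf' _ hjf ?_ ?_)).symm
      · exact fun h => hb1 (hext hjf hio h)
      · exact fun h => hb2 (hext hjf rfl h)
  rw [← hm, key m hmpos le_rfl]
  rcases hx with rfl | rfl
  · exfalso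
    -- The first edge of `B` after `i.symm` is `o`, so the edge `d` of `B` cannot come between them.
    obtain ⟨k, hk, hkb, hko⟩ := E.exists_next hi
    have hko' : (E.rot ^ k) i.symm = o :=
      hko.eq_of_fst hG hB ho ((E.rot_pow_fst _ _).trans hio)
    rcases le_or_gt k m with hkm | hkm
    · exact (hbetween k hk hkm).2 hko'
    · exact hkb m hmpos hkm (hm ▸ hd)
  · exact ho1

/-- `u` runs through the `n` vertices of the boundary of the outer face of `B` in clockwise
order. -/
structure IsOuterCycle (B : G.Subgraph) (n : ℕ) (u : ℕ → V) : Prop where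
  two_le : 2 ≤ n
  inj : ∀ i < n, ∀ j < n, u i = u j → i = j
  periodic : ∀ i, u (i + n) = u i
  outer : ∀ i, ∃ d, E.IsOuterDart B d ∧ d.fst = u i ∧ d.snd = u (i + 1)

theorem exists_isOuterCycle [Finite V] (hG : G.Preconnected) (hB : IsBlock B) {a : G.Dart}
    (ha : E.IsOuterDart B a) :
    ∃ n u, E.IsOuterCycle B n u ∧ u (n - 1) = a.fst ∧ u 0 = a.snd := by
  classical
  have := finite_dart (G := G)
  let O := {d : G.Dart // E.IsOuterDart B d}
  choose nx hnx hnx' using fun d : O => E.exists_next_fst d.2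
  let next : O → O := fun d => ⟨nx d, hnx d⟩
  have hnext : ∀ d : O, (next d).1.fst = d.1.snd := hnx'
  have hinj : Function.Injective next := by
    intro d d' h
    exact Subtype.ext (d.2.eq_of_snd hG hB d'.2 (by rw [← hnext, ← hnext, h]))
  -- Starting one step after `a` makes `a` the closing dart, from `u (n - 1)` to `u 0`.
  let x : O := next ⟨a, ha⟩
  let n := Function.minimalPeriod next x
  have hper : Function.IsPeriodicPt next n x := Function.isPeriodicPt_minimalPeriod _ _
  have hpos : 0 < n := Function.minimalPeriod_pos_of_mem_periodicPts
    (Function.Injective.mem_periodicPts hinj x)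
  let u : ℕ → V := fun i => (next^[i] x).1.fst
  have hu : ∀ i, (next^[i] x).1.snd = u (i + 1) := by
    intro i
    simp only [u, Function.iterate_succ_apply', hnext]
  have hn2 : 2 ≤ n := by
    by_contra h
    have h1 : n = 1 := by omega
    rw [h1] at hper
    have h2 : next x = x := hper
    have h3 := hnext x
    rw [h2] at h3
    exact x.1.adj.ne h3
  refine ⟨n, u, ⟨hn2, ?_, ?_, ?_⟩, ?_, ?_⟩
  · intro i hi j hj hij
    have h1 : next^[i] x = next^[j] x := Subtype.ext ((next^[i] x).2.eq_of_fst hG hB (next^[j] x).2 hij)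
    exact Function.iterate_injOn_Iio_minimalPeriod hi hj h1
  · intro i
    simp only [u, Function.iterate_add_apply]
    rw [hper]
  · exact fun i => ⟨_, (next^[i] x).2, rfl, hu i⟩
  · have h1 : next (next^[n - 1] x) = x := by
      rw [← Function.iterate_succ_apply' next, Nat.succ_eq_add_one, Nat.sub_add_cancel hpos]
      exact hper
    have h2 := hinj h1
    simp only [u, h2]
  · exact hnext ⟨a, ha⟩

end PlaneEmbedding

end OuterCycle

/-! ### The boundary cycle and crossing walks -/

section Crossing

variable {V : Type*} {G : SimpleGraph V}

/-- The walk through consecutive terms of a sequence of vertices. -/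
def seqWalk {u : ℕ → V} (hu : ∀ i, G.Adj (u i) (u (i + 1))) (i : ℕ) :
    (m : ℕ) → G.Walk (u i) (u (i + m))
  | 0 => Walk.nil
  | m + 1 => (seqWalk hu i m).concat (hu (i + m))

theorem seqWalk_edges {u : ℕ → V} (hu : ∀ i, G.Adj (u i) (u (i + 1))) (i m : ℕ) :
    (seqWalk hu i m).edges = (List.range m).map fun j => s(u (i + j), u (i + j + 1)) := by
  induction m with
  | zero => rfl
  | succ m ih =>
    rw [seqWalk, Walk.edges_concat, ih, List.range_succ, List.map_append, List.concat_eq_append]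
    rfl

theorem seqWalk_support {u : ℕ → V} (hu : ∀ i, G.Adj (u i) (u (i + 1))) (i m : ℕ) :
    (seqWalk hu i m).support = (List.range (m + 1)).map fun j => u (i + j) := by
  induction m with
  | zero => rfl
  | succ m ih =>
    rw [seqWalk, Walk.support_concat, ih, List.range_succ (n := m + 1), List.map_append]
    rfl

theorem seqWalk_length {u : ℕ → V} (hu : ∀ i, G.Adj (u i) (u (i + 1))) (i m : ℕ) :
    (seqWalk hu i m).length = m := by
  rw [← Walk.length_edges, seqWalk_edges, List.length_map, List.length_range]

namespace PlaneEmbedding.IsOuterCycle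

variable {E : PlaneEmbedding G} {B : G.Subgraph} {n : ℕ} {u : ℕ → V}

theorem adj (hC : E.IsOuterCycle B n u) (i : ℕ) : B.Adj (u i) (u (i + 1)) := by
  obtain ⟨d, hd, h1, h2⟩ := hC.outer i
  have : B.Adj d.fst d.snd := hd.1
  rwa [h1, h2] at this

theorem adj' (hC : E.IsOuterCycle B n u) (i : ℕ) : G.Adj (u i) (u (i + 1)) := B.adj_sub (hC.adj i)

theorem mem_verts (hC : E.IsOuterCycle B n u) (i : ℕ) : u i ∈ B.verts := B.edge_vert (hC.adj i)

theorem mod (hC : E.IsOuterCycle B n u) (i : ℕ) : u (i % n) = u i :=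
  Function.Periodic.map_mod_nat hC.periodic i

theorem eq_iff (hC : E.IsOuterCycle B n u) {i j : ℕ} : u i = u j ↔ i ≡ j [MOD n] := by
  have := hC.two_le
  constructor
  · intro h
    exact hC.inj _ (Nat.mod_lt _ (by omega)) _ (Nat.mod_lt _ (by omega)) (by rwa [hC.mod, hC.mod])
  · intro h
    rw [← hC.mod i, ← hC.mod j, h]

theorem succ_eq_iff (hC : E.IsOuterCycle B n u) {i j : ℕ} : u (i + 1) = u (j + 1) ↔ u i = u j := by
  rw [hC.eq_iff, hC.eq_iff]
  exact ⟨Nat.ModEq.add_right_cancel' 1, Nat.ModEq.add_right 1⟩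

theorem ne_add_two (hC : E.IsOuterCycle B n u) (hn : 3 ≤ n) (i : ℕ) : u i ≠ u (i + 2) := by
  intro h
  have := (Nat.modEq_iff_dvd' (by omega)).1 (hC.eq_iff.1 h)
  rw [Nat.add_sub_cancel_left] at this
  have := Nat.le_of_dvd (by omega) this
  omega

theorem eq_of_eq (hC : E.IsOuterCycle B n u) {i j k : ℕ} (h : u (k + i) = u (k + j)) (hi : i < n)
    (hj : j < n) : i = j := by
  have := Nat.ModEq.add_left_cancel' k (hC.eq_iff.1 h)
  rwa [Nat.ModEq, Nat.mod_eq_of_lt hi, Nat.mod_eq_of_lt hj] at this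

/-- For `n ≥ 3` at most one turn around the cycle repeats no edge. The hypotheses `h₁` and `h₂` say
that both boundary edges at `u (t + 1)` are traversed. -/
theorem count_seqWalk [DecidableEq V] (hC : E.IsOuterCycle B n u) (hn : 3 ≤ n) {k m t : ℕ}
    (hm : m ≤ n) (h₁ : ∃ j < m, u (k + j) = u t) (h₂ : ∃ j < m, u (k + j) = u (t + 1)) (d : G.Dart)
    (hd : d.fst = u (t + 1)) : (seqWalk hC.adj' k m).edges.count d.edge =
      if d.snd = u t ∨ d.snd = u (t + 2) then 1 else 0 := by
  have hnd : ((List.range m).map fun j => s(u (k + j), u (k + j + 1))).Nodup := by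
    refine List.Nodup.map_on ?_ List.nodup_range
    intro i hi j hj hij
    rw [List.mem_range] at hi hj
    rcases Sym2.eq_iff.1 hij with ⟨h, -⟩ | ⟨h, h'⟩
    · exact hC.eq_of_eq h (by omega) (by omega)
    · refine absurd ?_ (hC.ne_add_two hn (k + j))
      rw [← h', hC.succ_eq_iff (j := k + j + 1), h]
  rw [seqWalk_edges, hnd.count]
  congr 1
  have hde : d.edge = s(u (t + 1), d.snd) := by
    rw [← hd]
    rfl
  simp only [List.mem_map, List.mem_range, hde, eq_iff_iff, Sym2.eq_iff]
  constructor
  · rintro ⟨j, hj, ⟨h, h'⟩ | ⟨h, h'⟩⟩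
    · exact Or.inr (by rw [← h', hC.succ_eq_iff (j := t + 1), h])
    · exact Or.inl (by rw [← h]; exact hC.succ_eq_iff.1 h')
  · rintro (h | h)
    · obtain ⟨j, hj, hjt⟩ := h₁
      exact ⟨j, hj, Or.inr ⟨hjt.trans h.symm, hC.succ_eq_iff.2 hjt⟩⟩
    · obtain ⟨j, hj, hjt⟩ := h₂
      exact ⟨j, hj, Or.inl ⟨hjt, h ▸ hC.succ_eq_iff.2 hjt⟩⟩

theorem mem_edgeSet_of_mem_seqWalk (hC : E.IsOuterCycle B n u) {k m : ℕ} :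
    ∀ e ∈ (seqWalk hC.adj' k m).edges, e ∈ B.edgeSet := by
  intro e he
  rw [seqWalk_edges, List.mem_map] at he
  obtain ⟨j, -, rfl⟩ := he
  exact hC.adj _

/-- A closed walk of `B` that follows the boundary of the outer face at `u (t + 1)` has all other
edges of `B` at `u (t + 1)` in its interior. -/
theorem colour_eq_one (hC : E.IsOuterCycle B n u) [Finite V] [DecidableEq V] (hG : G.Preconnected) (hB : IsBlock B)
    (t : ℕ) {f : FaceOf E.rot → ZMod 2} (h0 : ∀ F, E.InOuterFace B F → f F = 0)
    (hf : ∀ d : G.Dart, d.fst = u (t + 1) → f (E.face d) + f (E.face d.symm) =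
      if d.snd = u t ∨ d.snd = u (t + 2) then 1 else 0)
    {d : G.Dart} (hd : d.edge ∈ B.edgeSet) (hdf : d.fst = u (t + 1)) (hds : d.snd ≠ u (t + 2)) :
    f (E.face d) = 1 := by
  obtain ⟨i, hi, hi1, hi2⟩ := hC.outer t
  obtain ⟨o, ho, ho1, ho2⟩ := hC.outer (t + 1)
  refine E.colour_eq_one hG hB h0 hi ho (hi2.trans ho1.symm) ?_ ?_ hd (hdf.trans ho1.symm)
    (by rwa [ho2])
  · intro d hd hd'
    rw [hf d (hd.trans ho1), if_pos]
    rwa [hi1, ho2] at hd'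
  · intro d hd hd' hd''
    rw [hf d (hd.trans ho1), if_neg]
    rw [hi1] at hd'
    rw [ho2] at hd''
    exact not_or.2 ⟨hd', hd''⟩

theorem exists_eq_add_one (hC : E.IsOuterCycle B n u) (i : ℕ) : ∃ t, u i = u (t + 1) := by
  have := hC.two_le
  exact ⟨i + n - 1, by rw [Nat.sub_add_cancel (by omega), hC.periodic]⟩

theorem exists_lt (hC : E.IsOuterCycle B n u) (k i : ℕ) : ∃ j < n, u (k + j) = u i := by
  have := hC.two_le
  have hk := Nat.mod_lt k (by omega : 0 < n)
  refine ⟨(i + (n - k % n)) % n, Nat.mod_lt _ (by omega), ?_⟩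
  rw [hC.eq_iff]
  have h1 : k + (i + (n - k % n)) % n ≡ k % n + (i + (n - k % n)) [MOD n] :=
    (Nat.ModEq.add (Nat.mod_modEq k n).symm (Nat.mod_modEq _ n))
  have h2 : k % n + (i + (n - k % n)) = i + n := by omega
  rw [h2] at h1
  exact h1.trans (Nat.add_modEq_right)

/-- The faces can be coloured such that the outer face of `B` has colour 0 and all faces at edges
of `B` inside its boundary cycle have colour 1. -/
theorem exists_inner_colouring (hC : E.IsOuterCycle B n u) [Finite V] (hG : G.Preconnected)
    (hB : IsBlock B) (hn : 3 ≤ n) :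
    ∃ f : FaceOf E.rot → ZMod 2, (∀ F, E.InOuterFace B F → f F = 0) ∧
      (∀ d : G.Dart, d.fst ∉ Set.range u → f (E.face d) = f (E.face d.symm)) ∧
      ∀ d : G.Dart, d.edge ∈ B.edgeSet → (∀ i, d.fst = u i → d.snd ≠ u (i + 1)) →
        f (E.face d) = 1 := by
  classical
  let w : G.Walk (u 0) (u 0) := (seqWalk hC.adj' 0 n).copy rfl (hC.periodic 0)
  have hwe : w.edges = (seqWalk hC.adj' 0 n).edges := Walk.edges_copy ..
  obtain ⟨f, h0, hf⟩ := E.exists_colouring_of_le (B := B) hG w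
    (hwe ▸ hC.mem_edgeSet_of_mem_seqWalk)
  have hoff : ∀ d : G.Dart, d.fst ∉ Set.range u → f (E.face d) = f (E.face d.symm) := by
    intro d hd
    have h1 := hf d
    rw [List.count_eq_zero_of_not_mem] at h1
    · exact CharTwo.add_eq_zero.1 (by simpa using h1)
    · rw [hwe, seqWalk_edges, List.mem_map]
      rintro ⟨j, -, h⟩
      have : d.fst ∈ s(u (0 + j), u (0 + j + 1)) := by
        rw [h]
        exact Sym2.mem_mk_left _ _
      rcases Sym2.mem_iff.1 this with h | h
      exacts [hd ⟨_, h.symm⟩, hd ⟨_, h.symm⟩]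
  have hon : ∀ i, ∀ d : G.Dart, d.edge ∈ B.edgeSet → d.fst = u i → d.snd ≠ u (i + 1) →
      f (E.face d) = 1 := by
    intro i d hd hdf hds
    obtain ⟨t, ht⟩ := hC.exists_eq_add_one i
    refine hC.colour_eq_one hG hB t h0 ?_ hd (hdf.trans ht) ?_
    · intro d hd
      rw [hf d, hwe, hC.count_seqWalk hn le_rfl (hC.exists_lt _ _) (hC.exists_lt _ _) d hd]
      split_ifs <;> simp
    · rwa [hC.succ_eq_iff.2 ht] at hds
  refine ⟨f, h0, hoff, ?_⟩
  -- Colour 1 spreads along walks of `B`: at a vertex off the cycle all faces have the same colour,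
  -- and at a vertex of the cycle the colour is already known from the local analysis.
  have key : ∀ x, Linked B ∅ (u 0) x → ∀ d : G.Dart, d.edge ∈ B.edgeSet → d.fst = x →
      (∀ i, d.fst = u i → d.snd ≠ u (i + 1)) → f (E.face d) = 1 := by
    intro x hx
    refine hx.induct (P := fun x => ∀ d : G.Dart, d.edge ∈ B.edgeSet → d.fst = x →
      (∀ i, d.fst = u i → d.snd ≠ u (i + 1)) → f (E.face d) = 1) ?_ ?_
    · exact fun d hd hd0 h => hon 0 d hd hd0 (h 0 hd0)
    · intro a b _ _ hab ih d hd hdb h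
      by_cases hb : b ∈ Set.range u
      · obtain ⟨i, rfl⟩ := hb
        exact hon i d hd hdb (h i hdb)
      · have hab' := B.adj_sub hab
        have h1 := ih ⟨(a, b), hab'⟩ hab rfl fun i _ hi => hb ⟨_, hi.symm⟩
        have h2 := hoff (Dart.symm ⟨(a, b), hab'⟩) hb
        rw [Dart.symm_symm, h1] at h2
        rw [← h2]
        exact E.colour_eq_of_fst_eq f (v := b) (fun d hd => hoff d (hd ▸ hb)) hdb rfl
  intro d hd h
  have hda : B.Adj d.fst d.snd := hd
  exact key d.fst (((isBlock_iff B).1 hB).2.1 _ (hC.mem_verts 0) _ (B.edge_vert hda)) d hd rfl h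

/-- The boundary of the outer face of a block is a single cycle. -/
theorem complete (hC : E.IsOuterCycle B n u) [Finite V] (hG : G.Preconnected)
    (hB : IsBlock B) {d : G.Dart} (hd : E.IsOuterDart B d) :
    ∃ i < n, d.fst = u i ∧ d.snd = u (i + 1) := by
  have hn2 := hC.two_le
  suffices h : ∃ i, d.fst = u i by
    obtain ⟨i, hi⟩ := h
    obtain ⟨o, ho, ho1, ho2⟩ := hC.outer (i % n)
    refine ⟨i % n, Nat.mod_lt _ (by omega), by rw [hC.mod, hi], ?_⟩
    rw [← ho2]
    exact congrArg (fun d : G.Dart => d.snd) (hd.eq_of_fst hG hB ho (by rw [hi, ho1, hC.mod]))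
  by_contra! hne
  have hda : B.Adj d.fst d.snd := hd.1
  rcases hn2.eq_or_lt with rfl | hn
  -- For `n = 2` the outer face is on both sides of the edge, which a further edge of the block at
  -- either end would forbid; so `B` is this edge.
  · have key : ∀ i, ∀ d' : G.Dart, d'.edge ∈ B.edgeSet → d'.fst = u i → d'.snd = u (i + 1) := by
      intro i d' hd' hi
      obtain ⟨o, ho, ho1, ho2⟩ := hC.outer i
      obtain ⟨o', ho', ho1', ho2'⟩ := hC.outer (i + 1)
      by_contra hs
      refine (E.not_outer_of_ne hG hB ho.1 hd' (ho1.trans hi.symm) ?_).2.2 ⟨ho.2, ?_⟩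
      · rintro rfl
        exact hs ho2
      · have : o.symm = o' := Dart.ext _ _ (Prod.ext (ho2.trans ho1'.symm)
          (by rw [ho2', hC.periodic]; exact ho1))
        rw [this]
        exact ho'.2
    have hlink := ((isBlock_iff B).1 hB).2.1 _ (hC.mem_verts 0) _ (B.edge_vert hda)
    have : d.fst ∈ Set.range u := by
      refine hlink.induct (P := (· ∈ Set.range u)) ⟨0, rfl⟩ ?_
      rintro _ b - - hab ⟨i, rfl⟩
      exact ⟨_, (key i ⟨(u i, b), B.adj_sub hab⟩ hab rfl).symm⟩
    obtain ⟨i, hi⟩ := this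
    exact hne i hi.symm
  · obtain ⟨f, h0, -, h1⟩ := hC.exists_inner_colouring hG hB hn
    have := h1 d hd.1 fun i hi => absurd hi (hne i)
    rw [h0 _ hd.2] at this
    exact zero_ne_one this

theorem mem_outerVerts_iff (hC : E.IsOuterCycle B n u) [Finite V] (hG : G.Preconnected)
    (hB : IsBlock B) {x : V} : x ∈ E.outerVerts B ↔ ∃ i < n, x = u i := by
  have hn2 := hC.two_le
  constructor
  · rintro ⟨_, ⟨d, hd, rfl⟩, hx⟩
    obtain ⟨i, hi, h1, h2⟩ := hC.complete hG hB hd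
    rcases Sym2.mem_iff.1 (show x ∈ s(d.fst, d.snd) from hx) with rfl | rfl
    · exact ⟨i, hi, h1⟩
    · exact ⟨(i + 1) % n, Nat.mod_lt _ (by omega), by rw [h2, hC.mod]⟩
  · rintro ⟨i, -, rfl⟩
    obtain ⟨d, hd, h1, -⟩ := hC.outer i
    exact ⟨_, ⟨d, hd, rfl⟩, h1 ▸ Sym2.mem_mk_left _ _⟩

/-- Two walks of `B` whose ends interlace on the boundary of the outer face have a common
vertex. -/
theorem crossing (hC : E.IsOuterCycle B n u) [Finite V] (hG : G.Preconnected)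
    (hB : IsBlock B) {i j k m : ℕ} (hij : i < j) (hjk : j < k) (hkm : k < m) (hm : m < n)
    (R : G.Walk (u i) (u k)) (hR : ∀ e ∈ R.edges, e ∈ B.edgeSet)
    (S : G.Walk (u j) (u m)) (hS : ∀ e ∈ S.edges, e ∈ B.edgeSet) :
    ∃ x ∈ R.support, x ∈ S.support := by
  classical
  by_contra! hdis
  have hn : 3 ≤ n := by omega
  -- Close `R` by following the boundary from `u k` past `u m` and on to `u (i + n) = u i`. This
  -- closed walk avoids `u j`, so the faces around `u j` have the colour 0 of the outer face.
  let w : G.Walk (u i) (u i) := R.append ((seqWalk hC.adj' k (i + n - k)).copy rfl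
    (by rw [show k + (i + n - k) = i + n by omega, hC.periodic]))
  have hwe : w.edges = R.edges ++ (seqWalk hC.adj' k (i + n - k)).edges := by
    simp only [w, Walk.edges_append, Walk.edges_copy]
  obtain ⟨f, h0, hf⟩ := E.exists_colouring_of_le (B := B) hG w (by
    intro e he
    rw [hwe, List.mem_append] at he
    exact he.elim (hR e) (hC.mem_edgeSet_of_mem_seqWalk e))
  let W : Set V := {x | x ∈ R.support ∨ ∃ t, k ≤ t ∧ t ≤ i + n ∧ x = u t}
  have hoff : ∀ d : G.Dart, d.fst ∉ W → f (E.face d) = f (E.face d.symm) := by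
    intro d hd
    have h1 := hf d
    rw [List.count_eq_zero_of_not_mem] at h1
    · exact CharTwo.add_eq_zero.1 (by simpa using h1)
    · rw [hwe, seqWalk_edges, List.mem_append, List.mem_map]
      rintro (h | ⟨j, hj, h⟩)
      · exact hd (Or.inl (R.fst_mem_support_of_mem_edges (t := d.fst) (u := d.snd) h))
      · rw [List.mem_range] at hj
        have : d.fst ∈ s(u (k + j), u (k + j + 1)) := by
          rw [h]
          exact Sym2.mem_mk_left _ _
        rcases Sym2.mem_iff.1 this with h | h
        exacts [hd (Or.inr ⟨_, by omega, by omega, h⟩), hd (Or.inr ⟨_, by omega, by omega, h⟩)]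
  have hjW : u j ∉ W := by
    rintro (h | ⟨t, ht, ht', h⟩)
    · exact hdis _ h S.start_mem_support
    · have h1 := (Nat.modEq_iff_dvd' (by omega)).1 (hC.eq_iff.1 h)
      have := Nat.le_of_dvd (by omega) h1
      omega
  have hmW : u m ∈ W := Or.inr ⟨m, by omega, by omega, rfl⟩
  -- Until `S` first meets `W` it sees only colour 0. It misses `R`, so it meets `W` at an inner
  -- vertex of the boundary arc, where edges of `B` arriving from elsewhere have colour 1.
  have key : ∀ {a b : V} (S : G.Walk a b), (∀ e ∈ S.edges, e ∈ B.edgeSet) → a ∉ W → b ∈ W →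
      (∀ x ∈ S.support, x ∉ R.support) → (∀ d : G.Dart, d.fst = a → f (E.face d) = 0) → False := by
    intro a b S
    induction S with
    | nil => exact fun _ ha hb => absurd hb ha
    | @cons a c b h p ih =>
      intro hS ha hb hSR h1
      simp only [Walk.edges_cons, List.mem_cons, forall_eq_or_imp, Walk.support_cons] at hS hSR
      have h2 : f (E.face (Dart.symm ⟨(a, c), h⟩)) = 0 := by
        rw [← hoff ⟨(a, c), h⟩ ha, h1 _ rfl]
      by_cases hc : c ∈ W
      · have hcR := hSR.2 c p.start_mem_support
        rcases hc with hc | ⟨t, hkt, hti, rfl⟩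
        · exact hcR hc
        · have hkt' : k < t := hkt.lt_of_ne (by rintro rfl; exact hcR R.end_mem_support)
          have hti' : t < i + n := hti.lt_of_ne (by
            rintro rfl
            rw [hC.periodic] at hcR
            exact hcR R.start_mem_support)
          obtain ⟨t, rfl⟩ : ∃ t', t = t' + 1 := ⟨t - 1, by omega⟩
          have h3 : f (E.face (Dart.symm ⟨(a, u (t + 1)), h⟩)) = 1 := by
            refine hC.colour_eq_one hG hB t h0 ?_ ?_ rfl ?_
            · intro d hd
              rw [hf d, hwe, List.count_append, hC.count_seqWalk hn (by omega)
                ⟨t - k, by omega, by rw [Nat.add_sub_cancel' (by omega)]⟩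
                ⟨t + 1 - k, by omega, by rw [Nat.add_sub_cancel' (by omega)]⟩ d hd,
                List.count_eq_zero_of_not_mem]
              · split_ifs <;> simp
              · intro h
                have := R.fst_mem_support_of_mem_edges (t := d.fst) (u := d.snd) h
                rw [hd] at this
                exact hcR this
            · rw [Dart.edge_symm]
              exact hS.1
            · intro h
              exact ha (Or.inr ⟨t + 2, by omega, by omega, h⟩)
          rw [h2] at h3
          exact zero_ne_one h3
      · refine ih hS.2 hc hb hSR.2 fun d hd => ?_
        rw [← h2]
        exact E.colour_eq_of_fst_eq f (v := c) (fun d hd => hoff d (hd ▸ hc)) hd rfl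
  refine key S hS hjW hmW (fun x hx hx' => hdis x hx' hx) fun d hd => ?_
  obtain ⟨o, ho, ho1, -⟩ := hC.outer j
  rw [← h0 _ ho.2]
  exact E.colour_eq_of_fst_eq f (v := u j) (fun d hd => hoff d (hd ▸ hjW)) hd ho1

end PlaneEmbedding.IsOuterCycle

end Crossing

/-! ### Boundary paths as intervals of indices -/

section Segments

variable {V : Type*}

theorem IsBlock.linked {A : SimpleGraph V} {K : A.Subgraph} (h : IsBlock K) {x y : V}
    (hx : x ∈ K.verts) (hy : y ∈ K.verts) : Linked K ∅ x y :=
  ((isBlock_iff K).1 h).2.1 x hx y hy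

theorem IsBlock.linked_singleton {A : SimpleGraph V} {K : A.Subgraph} (h : IsBlock K) {v x y : V}
    (hx : x ∈ K.verts) (hxv : x ≠ v) (hy : y ∈ K.verts) (hyv : y ≠ v) : Linked K {v} x y :=
  ((isBlock_iff K).1 h).2.2 v x hx hxv y hy hyv

/-- Every component of a block minus two vertices is attached to both of them. -/
theorem IsBlock.exists_attachment {A : SimpleGraph V} {K : A.Subgraph} (h : IsBlock K) {c d y : V}
    (hc : c ∈ K.verts) (hcd : c ≠ d) (hy : y ∈ K.verts) (hyc : y ≠ c) (hyd : y ≠ d) :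
    ∃ z, Linked K {c, d} y z ∧ K.Adj z c := by
  have key := (h.linked_singleton hy hyd hc hcd).induct
    (P := fun x => Linked K {c, d} y x ∨ ∃ z, Linked K {c, d} y z ∧ K.Adj z c)
    (Or.inl (Linked.refl y)) ?_
  · refine key.resolve_left fun hl => ?_
    exact hl.notMem (by simp [hyc, hyd]) (by simp)
  · rintro a b ha hb hab (ih | ih)
    · by_cases hbc : b = c
      · exact Or.inr ⟨a, ih, hbc ▸ hab⟩
      · refine Or.inl (ih.trans (Linked.of_adj hab ?_ ?_))
        · exact ih.notMem (by simp [hyc, hyd])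
        · rintro (h | h)
          exacts [hbc h, hb h]
    · exact Or.inr ih

theorem toSubgraph_le_toSubgraph_iff {G : SimpleGraph V} {a b c d : V} {p : G.Walk a b}
    {q : G.Walk c d} : p.toSubgraph ≤ q.toSubgraph ↔
      (∀ x ∈ p.support, x ∈ q.support) ∧ ∀ e ∈ p.edges, e ∈ q.edges := by
  constructor
  · intro h
    refine ⟨fun x hx => ?_, fun e he => ?_⟩
    · rw [← Walk.mem_verts_toSubgraph] at hx ⊢
      exact h.1 hx
    · rw [← Walk.mem_edges_toSubgraph] at he ⊢
      exact Subgraph.edgeSet_mono h he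
  · rintro ⟨h1, h2⟩
    refine ⟨fun x hx => ?_, fun x y hxy => ?_⟩
    · rw [Walk.mem_verts_toSubgraph] at hx ⊢
      exact h1 x hx
    · have h3 : s(x, y) ∈ p.toSubgraph.edgeSet := hxy
      rw [Walk.mem_edges_toSubgraph] at h3
      have := h2 _ h3
      rwa [← Walk.mem_edges_toSubgraph] at this

/-- The inner vertices of a path have degree 2 in it and its ends have degree at most 1. -/
theorem IsInner.of_toSubgraph_le [Finite V] {G : SimpleGraph V} {a b c d v : V} {p : G.Walk a b}
    {q : G.Walk c d} (hp : p.IsPath) (hq : q.IsPath) (h : p.toSubgraph ≤ q.toSubgraph)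
    (hv : IsInner p v) : IsInner q v := by
  obtain ⟨hvp, hva, hvb⟩ := hv
  refine ⟨(toSubgraph_le_toSubgraph_iff.1 h).1 v hvp, ?_⟩
  obtain ⟨i, rfl, hi⟩ := Walk.mem_support_iff_exists_getVert.1 hvp
  have hi0 : i ≠ 0 := by
    rintro rfl
    exact hva (Walk.getVert_zero p)
  have hil : i < p.length := hi.lt_of_ne fun h => hvb (h ▸ p.getVert_length)
  have h2 := hp.ncard_neighborSet_toSubgraph_internal_eq_two hi0 hil
  have hle : (p.toSubgraph.neighborSet (p.getVert i)).ncard ≤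
      (q.toSubgraph.neighborSet (p.getVert i)).ncard :=
    Set.ncard_le_ncard (fun x hx => h.2 hx) (Set.toFinite _)
  have hqn : ¬ q.Nil := by
    intro hq'
    have : ∀ e ∈ p.edges, e ∈ q.edges := (toSubgraph_le_toSubgraph_iff.1 h).2
    have hqe : q.edges = [] := by
      rw [← List.length_eq_zero_iff, Walk.length_edges]
      exact Walk.length_eq_zero_iff.2 hq'
    rw [hqe] at this
    have hpe : p.edges = [] := List.eq_nil_iff_forall_not_mem.2 fun e he => by simpa using this e he
    rw [← List.length_eq_zero_iff, Walk.length_edges] at hpe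
    omega
  constructor
  · intro hc
    rw [hc, hq.neighborSet_toSubgraph_startpoint hqn, Set.ncard_singleton, ← hc, h2] at hle
    omega
  · intro hc
    rw [hc, hq.neighborSet_toSubgraph_endpoint hqn, Set.ncard_singleton, ← hc, h2] at hle
    omega

namespace PlaneEmbedding

variable {G : SimpleGraph V} {E : PlaneEmbedding G} {B : G.Subgraph} {n : ℕ} {u : ℕ → V}
  {α : Sym2 V}

/-- A block `B` with the vertices of its boundary numbered such that the edge `α` joins the last
one to the first one. -/
structure IsFrame (E : PlaneEmbedding G) (B : G.Subgraph) (n : ℕ) (u : ℕ → V) (α : Sym2 V) :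
    Prop extends E.IsOuterCycle B n u where
  conn : G.Preconnected
  block : IsBlock B
  edge_eq : α = s(u (n - 1), u 0)

/-- `p` is the path `u i, …, u j`. -/
structure IsSegment (n : ℕ) (u : ℕ → V) {c d : V} (p : G.Walk c d) (i j : ℕ) : Prop where
  lt : i < j
  lt' : j < n
  start : c = u i
  finish : d = u j
  length : p.length = j - i
  mem_support : ∀ x, x ∈ p.support ↔ ∃ m, i ≤ m ∧ m ≤ j ∧ x = u m
  mem_edges : ∀ e, e ∈ p.edges ↔ ∃ m, i ≤ m ∧ m < j ∧ e = s(u m, u (m + 1))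

/-- Outer darts are determined by their first vertex, so such a walk has to run through consecutive
terms of `u`. Indices may pass `n` here. -/
theorem IsArc.support_edges [Finite V] (hF : E.IsFrame B n u α) {c d : V} {p : G.Walk c d}
    (hp : ∀ f ∈ p.darts, E.IsOuterDart B f) {i : ℕ} (hi : c = u i) :
    d = u (i + p.length) ∧ (∀ x, x ∈ p.support ↔ ∃ m, i ≤ m ∧ m ≤ i + p.length ∧ x = u m) ∧
    ∀ e, e ∈ p.edges ↔ ∃ m, i ≤ m ∧ m < i + p.length ∧ e = s(u m, u (m + 1)) := by
  induction p generalizing i with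
  | nil =>
    refine ⟨hi, fun x => ?_, fun e => ?_⟩
    · simp only [Walk.support_nil, List.mem_singleton, Walk.length_nil, add_zero]
      constructor
      · rintro rfl
        exact ⟨i, le_rfl, le_rfl, hi⟩
      · rintro ⟨m, h1, h2, rfl⟩
        rw [le_antisymm h2 h1, hi]
    · simp only [Walk.edges_nil, List.not_mem_nil, Walk.length_nil, add_zero, false_iff]
      rintro ⟨m, h1, h2, -⟩
      omega
  | @cons a b c h p ih =>
    simp only [Walk.darts_cons, List.mem_cons, forall_eq_or_imp] at hp
    obtain ⟨o, ho, ho1, ho2⟩ := hF.outer i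
    have hb : b = u (i + 1) := by
      have := hp.1.eq_of_fst hF.conn hF.block ho (hi.trans ho1.symm)
      rw [← ho2, ← this]
    obtain ⟨h1, h2, h3⟩ := ih hp.2 hb
    refine ⟨?_, fun x => ?_, fun e => ?_⟩
    · refine h1.trans (congrArg u ?_)
      rw [Walk.length_cons]
      omega
    · rw [Walk.support_cons, List.mem_cons, h2, Walk.length_cons]
      constructor
      · rintro (rfl | ⟨m, hm, hm', rfl⟩)
        · exact ⟨i, le_rfl, by omega, hi⟩
        · exact ⟨m, by omega, by omega, rfl⟩
      · rintro ⟨m, hm, hm', rfl⟩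
        rcases hm.eq_or_lt with rfl | hm
        · exact Or.inl hi.symm
        · exact Or.inr ⟨m, by omega, by omega, rfl⟩
    · rw [Walk.edges_cons, List.mem_cons, h3, Walk.length_cons]
      constructor
      · rintro (rfl | ⟨m, hm, hm', rfl⟩)
        · exact ⟨i, le_rfl, by omega, by rw [hi, hb]⟩
        · exact ⟨m, by omega, by omega, rfl⟩
      · rintro ⟨m, hm, hm', rfl⟩
        rcases hm.eq_or_lt with rfl | hm
        · exact Or.inl (by rw [hi, hb])
        · exact Or.inr ⟨m, by omega, by omega, rfl⟩

/-- A path on the boundary without an end of `α` as an inner vertex is a segment, or just `α`. -/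
theorem IsArc.segment_or [Finite V] (hF : E.IsFrame B n u α) {c d : V} {p : G.Walk c d}
    (hp : E.IsArc B p) (hcd : c ≠ d) (hin : ∀ v, IsInner p v → v ∉ α) :
    (∃ i j, IsSegment n u p i j) ∨ (c = u (n - 1) ∧ d = u 0 ∧ p.length = 1) := by
  have hn := hF.two_le
  have hpos : 0 < p.length := by
    rw [Nat.pos_iff_ne_zero]
    exact fun h => hcd (Walk.eq_of_length_eq_zero h)
  obtain ⟨i, hi, hci⟩ : ∃ i < n, c = u i := by
    obtain ⟨a, ha⟩ : ∃ a, a ∈ p.darts := List.exists_mem_of_length_pos (by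
      rwa [Walk.length_darts])
    cases p with
    | nil => simp at hpos
    | cons h q =>
      obtain ⟨i, hi, h1, -⟩ := hF.complete hF.conn hF.block (hp.2 ⟨(_, _), h⟩ (by simp))
      exact ⟨i, hi, h1⟩
  obtain ⟨hd, hs, he⟩ := IsArc.support_edges hF hp.2 hci
  rcases lt_or_ge (i + p.length) n with hlt | hge
  · exact Or.inl ⟨i, i + p.length, by omega, hlt, hci, hd, by omega, hs, he⟩
  · right
    -- A path reaching index `n` contains both ends `u (n - 1)` and `u n = u 0` of `α`. As neither
    -- is an inner vertex, these are its first and its last vertex.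
    have hmem : ∀ m, i ≤ m → m ≤ i + p.length → u m ∈ α → u m = c ∨ u m = d := by
      intro m h1 h2 h3
      by_contra! h
      exact hin (u m) ⟨(hs _).2 ⟨m, h1, h2, rfl⟩, h⟩ h3
    have hin' : ∀ m m', i ≤ m → m ≤ i + p.length → i ≤ m' → m' ≤ i + p.length → u m = u m' →
        m = m' := by
      have hgv : ∀ k, ∀ {c d : V} (p : G.Walk c d) (i : ℕ), c = u i →
          (∀ f ∈ p.darts, E.IsOuterDart B f) → k ≤ p.length → p.getVert k = u (i + k) := by
        intro k c d p i hci hp hk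
        have := (IsArc.support_edges hF (p := p.take k) (i := i)
          (fun f hf => hp f ((p.isSubwalk_take k).darts_subset hf)) hci).1
        rwa [Walk.take_length, min_eq_left hk] at this
      intro m m' h1 h2 h3 h4 h
      have e1 := hgv (m - i) p i hci hp.2 (by omega)
      have e2 := hgv (m' - i) p i hci hp.2 (by omega)
      rw [Nat.add_sub_cancel' h1] at e1
      rw [Nat.add_sub_cancel' h3] at e2
      have := hp.1.getVert_injOn (by simp; omega) (by simp; omega) (e1.trans (h.trans e2.symm))
      omega
    have h1 : i = n - 1 := by
      rcases hmem (n - 1) (by omega) (by omega) (by rw [hF.edge_eq]; simp) with h | h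
      · rw [hci] at h
        exact (hin' _ _ (by omega) (by omega) le_rfl (by omega) h).symm
      · rw [hd] at h
        have := hin' _ _ (by omega) (by omega) (by omega) le_rfl h
        omega
    have hun : u n = u 0 := by
      have := hF.periodic 0
      rwa [zero_add] at this
    have h2 : p.length = 1 := by
      rcases hmem n (by omega) (by omega) (by rw [hF.edge_eq, hun]; simp) with h | h
      · rw [hci] at h
        have := hin' _ _ (by omega) (by omega) le_rfl (by omega) h
        omega
      · rw [hd] at h
        have := hin' _ _ (by omega) (by omega) (by omega) le_rfl h
        omega
    refine ⟨h1 ▸ hci, ?_, h2⟩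
    rw [hd, h2, h1, Nat.sub_add_cancel (by omega), hun]

theorem IsFrame.exists_segment [Finite V] (hF : E.IsFrame B n u α) {i j : ℕ} (hij : i < j)
    (hj : j < n) : ∃ p : G.Walk (u i) (u j), E.IsArc B p ∧ IsSegment n u p i j := by
  let p : G.Walk (u i) (u j) := (seqWalk hF.adj' i (j - i)).copy rfl
    (by rw [Nat.add_sub_cancel' hij.le])
  have hd : ∀ f ∈ p.darts, E.IsOuterDart B f := by
    have key : ∀ m, ∀ f ∈ (seqWalk hF.adj' i m).darts, E.IsOuterDart B f := by
      intro m
      induction m with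
      | zero => simp [seqWalk]
      | succ m ih =>
        intro f hf
        rw [seqWalk, Walk.darts_concat, List.concat_eq_append, List.mem_append,
          List.mem_singleton] at hf
        rcases hf with hf | rfl
        · exact ih f hf
        · obtain ⟨o, ho, ho1, ho2⟩ := hF.outer (i + m)
          have : (⟨(u (i + m), u (i + m + 1)), hF.adj' (i + m)⟩ : G.Dart) = o :=
            Dart.ext _ _ (Prod.ext ho1.symm ho2.symm)
          exact this ▸ ho
    intro f hf
    simp only [p, Walk.darts_copy] at hf
    exact key _ f hf
  have hl : p.length = j - i := by
    simp only [p, Walk.length_copy, seqWalk_length]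
  have hpath : p.IsPath := by
    rw [Walk.isPath_def]
    simp only [p, Walk.support_copy, seqWalk_support]
    refine List.Nodup.map_on ?_ List.nodup_range
    intro a ha b hb hab
    rw [List.mem_range] at ha hb
    exact hF.eq_of_eq hab (by omega) (by omega)
  obtain ⟨-, h2, h3⟩ := IsArc.support_edges hF hd (i := i) rfl
  rw [hl, Nat.add_sub_cancel' hij.le] at h2 h3
  exact ⟨p, ⟨hpath, hd⟩, hij, hj, rfl, rfl, hl, h2, h3⟩

theorem IsSegment.isInner_iff (hF : E.IsFrame B n u α) {c d : V} {p : G.Walk c d} {i j : ℕ}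
    (hp : IsSegment n u p i j) {x : V} : IsInner p x ↔ ∃ m, i < m ∧ m < j ∧ x = u m := by
  have hlt := hp.lt
  have hlt' := hp.lt'
  rw [IsInner, hp.mem_support, hp.start, hp.finish]
  constructor
  · rintro ⟨⟨m, h1, h2, rfl⟩, h3, h4⟩
    exact ⟨m, h1.lt_of_ne fun h => h3 (h ▸ rfl), h2.lt_of_ne fun h => h4 (h ▸ rfl), rfl⟩
  · rintro ⟨m, h1, h2, rfl⟩
    refine ⟨⟨m, h1.le, h2.le, rfl⟩, fun h => ?_, fun h => ?_⟩
    · have := hF.inj _ (by omega) _ (by omega) h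
      omega
    · have := hF.inj _ (by omega) _ (by omega) h
      omega

theorem IsSegment.toSubgraph_le_iff (hF : E.IsFrame B n u α) {c d c' d' : V} {p : G.Walk c d}
    {q : G.Walk c' d'} {i j i' j' : ℕ} (hp : IsSegment n u p i j) (hq : IsSegment n u q i' j') :
    p.toSubgraph ≤ q.toSubgraph ↔ i' ≤ i ∧ j ≤ j' := by
  have hlt := hp.lt
  have hlt' := hp.lt'
  have hqlt' := hq.lt'
  rw [toSubgraph_le_toSubgraph_iff]
  simp only [hp.mem_support, hq.mem_support, hp.mem_edges, hq.mem_edges]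
  constructor
  · rintro ⟨h, -⟩
    obtain ⟨m, h1, h2, h3⟩ := h (u i) ⟨i, le_rfl, hlt.le, rfl⟩
    have := hF.inj _ (by omega) _ (by omega) h3
    obtain ⟨m', h1', h2', h3'⟩ := h (u j) ⟨j, hlt.le, le_rfl, rfl⟩
    have := hF.inj _ (by omega) _ (by omega) h3'
    omega
  · rintro ⟨h, h'⟩
    exact ⟨fun x ⟨m, h1, h2, h3⟩ => ⟨m, by omega, by omega, h3⟩,
      fun x ⟨m, h1, h2, h3⟩ => ⟨m, by omega, by omega, h3⟩⟩

end PlaneEmbedding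

end Segments

/-! ### Bridges of 2-separators and the vertices that are split off -/

section Splitting

variable {V : Type*}

theorem isComponentSet_deleteVerts_iff {A : SimpleGraph V} {K : A.Subgraph} {S D : Set V} :
    IsComponentSet (K.deleteVerts S) D ↔ ∃ v ∈ K.verts, v ∉ S ∧ D = {z | Linked K S v z} := by
  constructor
  · rintro ⟨v, ⟨hv, hvS⟩, rfl⟩
    exact ⟨v, hv, hvS, rfl⟩
  · rintro ⟨v, hv, hvS, rfl⟩
    exact ⟨v, ⟨hv, hvS⟩, rfl⟩

theorem mem_incidentSubgraph_iff {A : SimpleGraph V} {K : A.Subgraph} {S : Set V} {v z : V}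
    (hv : v ∈ K.verts) (hvS : v ∉ S) (hz : z ∉ S) :
    z ∈ (incidentSubgraph K {z | Linked K S v z}).verts ↔ Linked K S v z := by
  constructor
  · rintro ⟨hzK, hz' | ⟨y, hy, hyz⟩⟩
    · exact hz'
    · exact Linked.trans hy (Linked.of_adj hyz (hy.notMem hvS) hz)
  · exact fun h => ⟨h.mem_verts hv, Or.inl h⟩

section Pairs

variable {A : SimpleGraph V} {K J : A.Subgraph} {c d z : V}

/-- The internal vertices of a `{c, d}`-bridge form a component of the rest. -/
theorem IsBridgeOf.internal_iff (h : IsBridgeOf K (edgelessOn A {c, d}) J) (hz : z ∈ J.verts)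
    (hzc : z ≠ c) (hzd : z ≠ d) (y : V) :
    (y ∈ J.verts ∧ y ≠ c ∧ y ≠ d) ↔ Linked K {c, d} z y := by
  rcases h with ⟨a, b, hab, ha, hb, -, rfl⟩ | ⟨D, hD, rfl⟩
  · exfalso
    have hz' : z = a ∨ z = b := hz
    have ha' : a = c ∨ a = d := ha
    have hb' : b = c ∨ b = d := hb
    grind
  · obtain ⟨v, hv, hvS, rfl⟩ := isComponentSet_deleteVerts_iff.1 hD
    have hvS' : v ∉ ({c, d} : Set V) := hvS
    have hmem : ∀ {y}, y ∉ ({c, d} : Set V) → (y ∈ (incidentSubgraph K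
        {z | Linked K (edgelessOn A {c, d}).verts v z}).verts ↔ Linked K {c, d} v y) :=
      fun hy => mem_incidentSubgraph_iff hv hvS hy
    have hzS : z ∉ ({c, d} : Set V) := by simp [hzc, hzd]
    have h1 := (hmem hzS).1 hz
    constructor
    · rintro ⟨h2, h3, h4⟩
      exact h1.symm.trans ((hmem (by simp [h3, h4])).1 h2)
    · intro h2
      have h3 := h2.notMem hzS
      refine ⟨(hmem h3).2 (h1.trans h2), ?_⟩
      simpa using h3

theorem IsBridgeOf.no_internal (h : IsBridgeOf K (edgelessOn A {c, d}) J) (hcd : J.Adj c d)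
    (hz : z ∈ J.verts) : z = c ∨ z = d := by
  rcases h with ⟨a, b, hab, ha, hb, -, rfl⟩ | ⟨D, hD, rfl⟩
  · have hz' : z = a ∨ z = b := hz
    have ha' : a = c ∨ a = d := ha
    have hb' : b = c ∨ b = d := hb
    grind
  · obtain ⟨v, hv, hvS, rfl⟩ := isComponentSet_deleteVerts_iff.1 hD
    have hvS' : v ∉ ({c, d} : Set V) := hvS
    rcases hcd.2 with h | h
    · exact absurd (Linked.notMem (S := {c, d}) h hvS') (by simp)
    · exact absurd (Linked.notMem (S := {c, d}) h hvS') (by simp)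

end Pairs

theorem adj_toSubgraph_of_length_eq_one {G : SimpleGraph V} {c d : V} {p : G.Walk c d}
    (h : p.length = 1) : p.toSubgraph.Adj c d ∧ (∀ x ∈ p.support, x = c ∨ x = d) ∧
      p.edges = [s(c, d)] := by
  cases p with
  | nil => simp at h
  | cons hab p =>
    cases p with
    | nil => simp
    | cons _ _ => simp at h

namespace PlaneEmbedding

variable {G : SimpleGraph V} {E : PlaneEmbedding G} {B : G.Subgraph} {n : ℕ} {u : ℕ → V}
  {s t : V} {α : Sym2 V} {i j : ℕ}

theorem IsFrame.eq_of_lt (hF : E.IsFrame B n u α) {i j : ℕ} (hi : i < n) (hj : j < n)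
    (h : u i = u j) : i = j := hF.inj _ hi _ hj h

theorem IsFrame.linked_segment (hF : E.IsFrame B n u α) {i j k m : ℕ} (hj : j < n) (hk : i < k)
    (hkm : k ≤ m) (hm : m < j) : Linked B {u i, u j} (u k) (u m) := by
  induction m, hkm using Nat.le_induction with
  | base => exact Linked.refl _
  | succ m hkm ih =>
    have hmem : ∀ l, i < l → l < j → u l ∉ ({u i, u j} : Set V) := by
      rintro l h1 h2 (h | h)
      · have := hF.eq_of_lt (by omega) (by omega) h
        omega
      · have := hF.eq_of_lt (by omega) (by omega) h
        omega
    exact (ih (by omega)).trans (Linked.of_adj (hF.adj m) (hmem _ (by omega) (by omega))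
      (hmem _ (by omega) hm))

theorem IsFrame.notMem_pair (hF : E.IsFrame B n u α) {i j k : ℕ} (hi : i < n) (hj : j < n)
    (hk : k < n) (hki : k ≠ i) (hkj : k ≠ j) : u k ∉ ({u i, u j} : Set V) := by
  rintro (h | h)
  exacts [hki (hF.eq_of_lt hk hi h), hkj (hF.eq_of_lt hk hj h)]

/-- The bridge of a 2-separator on the side of a segment of the boundary contains no other vertex
of the boundary. -/
theorem IsFrame.lt_of_linked [Finite V] (hF : E.IsFrame B n u α) {i j m : ℕ} (hij : i + 2 ≤ j)
    (hj : j < n) (hsep : IsTwoSeparator B (u i) (u j)) (hm : m < n)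
    (h : Linked B {u i, u j} (u (i + 1)) (u m)) : i < m ∧ m < j := by
  have h1 : u (i + 1) ∉ ({u i, u j} : Set V) :=
    hF.notMem_pair (by omega) (by omega) (by omega) (by omega) (by omega)
  have hne : u i ≠ u j := hsep.1
  -- The component of `y` differs from that of `u (i + 1)` but is attached to both `u i` and `u j`.
  -- A path through it would cross any walk from `u (i + 1)` to a boundary vertex outside the
  -- interval.
  obtain ⟨y, hy, hyS, hyn⟩ : ∃ y ∈ B.verts, y ∉ ({u i, u j} : Set V) ∧
      ¬ Linked B {u i, u j} (u (i + 1)) y := by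
    obtain ⟨-, x, hx, hxS, y, hy, hyS, hxy⟩ := (isSeparator_iff _ _).1 hsep.2
    by_cases hx1 : Linked B {u i, u j} (u (i + 1)) x
    · exact ⟨y, hy, hyS, fun h => hxy (hx1.symm.trans h)⟩
    · exact ⟨x, hx, hxS, hx1⟩
  have hyS' : y ≠ u i ∧ y ≠ u j := by simpa using hyS
  obtain ⟨y₁, hy₁, ha₁⟩ := hF.block.exists_attachment (hF.mem_verts i) hne hy hyS'.1 hyS'.2
  obtain ⟨y₂, hy₂, ha₂⟩ := hF.block.exists_attachment (hF.mem_verts j) hne.symm hy hyS'.2 hyS'.1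
  rw [Set.pair_comm] at hy₂
  obtain ⟨p, hp, hps⟩ := (hy₁.symm.trans hy₂).exists_walk (hy₁.notMem hyS)
  let R : G.Walk (u i) (u j) := Walk.cons (B.adj_sub ha₁.symm) (p.concat (B.adj_sub ha₂))
  have hR : ∀ e ∈ R.edges, e ∈ B.edgeSet := by
    intro e he
    simp only [R, Walk.edges_cons, Walk.edges_concat, List.concat_eq_append, List.mem_cons,
      List.mem_append, List.not_mem_nil, or_false] at he
    rcases he with rfl | he | rfl
    exacts [ha₁.symm, hp e he, ha₂]
  have hRs : ∀ x ∈ R.support, x ∈ ({u i, u j} : Set V) ∨ Linked B {u i, u j} y x := by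
    intro x hx
    simp only [R, Walk.support_cons, Walk.support_concat, List.mem_cons,
      List.mem_append, List.not_mem_nil, or_false] at hx
    rcases hx with rfl | hx | rfl
    · simp
    · exact Or.inr (hy₁.trans (hps x hx).2)
    · simp
  have hdis : ∀ x ∈ R.support, x ∉ ({u i, u j} : Set V) →
      ¬ Linked B {u i, u j} (u (i + 1)) x := by
    intro x hx hxS hl
    exact hyn (hl.trans ((hRs x hx).resolve_left hxS).symm)
  have hmS := h.notMem h1
  have hmi : m ≠ i := by
    rintro rfl
    simp at hmS
  have hmj : m ≠ j := by
    rintro rfl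
    simp at hmS
  by_contra hcon
  rcases Nat.lt_or_gt_of_ne hmi with hlt | hgt
  · obtain ⟨S, hS, hSs⟩ := h.symm.exists_walk hmS
    obtain ⟨x, hx, hx'⟩ := hF.crossing hF.conn hF.block hlt (by omega : i < i + 1) (by omega) hj
      S hS R hR
    exact hdis x hx' (hSs x hx).1 (h.trans (hSs x hx).2)
  · obtain ⟨S, hS, hSs⟩ := h.exists_walk h1
    obtain ⟨x, hx, hx'⟩ := hF.crossing hF.conn hF.block (by omega : i < i + 1) (by omega)
      (by omega : j < m) hm R hR S hS
    exact hdis x hx (hSs x hx').1 (hSs x hx').2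

/-- `u i, …, u j` is the path of a maximal 2-separator, and it has an inner vertex. -/
def IsMaxSegment (E : PlaneEmbedding G) (B : G.Subgraph) (n : ℕ) (u : ℕ → V) (s t : V)
    (α : Sym2 V) (i j : ℕ) : Prop :=
  i + 2 ≤ j ∧ ∃ p : G.Walk (u i) (u j), IsSegment n u p i j ∧ E.IsMaximalSeparator B s t α p

theorem mem_boundaryPoints_of_mem {v : V} (h : v ∈ α) : v ∈ E.boundaryPoints B s t α :=
  Or.inl (Or.inr h)

theorem IsMaximalSeparator.not_mem_boundaryPoints [Finite V] {c d : V} {p : G.Walk c d}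
    (h : E.IsMaximalSeparator B s t α p) {v : V} (hv : IsInner p v) :
    v ∉ E.boundaryPoints B s t α := by
  obtain ⟨-, hp, Z, ⟨⟨a, b, q, hq, hqb, rfl⟩, -⟩, hpZ, -⟩ := h
  exact hqb v (hv.of_toSubgraph_le hp.1 hq.1 hpZ)

theorem IsMaximalSeparator.segment_or [Finite V] (hF : E.IsFrame B n u α) {c d : V}
    {p : G.Walk c d} (h : E.IsMaximalSeparator B s t α p) :
    (∃ i j, IsSegment n u p i j) ∨ (c = u (n - 1) ∧ d = u 0 ∧ p.length = 1) :=
  h.2.1.segment_or hF h.1.1 fun _ hv hvα => h.not_mem_boundaryPoints hv (mem_boundaryPoints_of_mem hvα)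

theorem IsMaxSegment.lt (h : E.IsMaxSegment B n u s t α i j) : i + 2 ≤ j ∧ j < n :=
  let ⟨h1, _, h2, _⟩ := h
  ⟨h1, h2.lt'⟩

theorem IsMaxSegment.sep (h : E.IsMaxSegment B n u s t α i j) : IsTwoSeparator B (u i) (u j) :=
  let ⟨_, _, _, h2⟩ := h
  h2.1

/-- Maximality in terms of indices: `[a, b]` is the boundary part, a maximal interval without
boundary points inside, and `[i, j]` cannot be enlarged to another separator in `[a, b]`. The inner
vertex `u (i + 1)` excludes that the part is the edge `α`. -/
theorem IsMaxSegment.exists_part [Finite V] (hF : E.IsFrame B n u α)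
    (h : E.IsMaxSegment B n u s t α i j) :
    ∃ a b, a ≤ i ∧ j ≤ b ∧ b < n ∧ (∀ m, a < m → m < b → u m ∉ E.boundaryPoints B s t α) ∧
      (∀ a' b', a' ≤ a → b ≤ b' → b' < n →
        (∀ m, a' < m → m < b' → u m ∉ E.boundaryPoints B s t α) → a' = a ∧ b' = b) ∧
      ∀ i' j', a ≤ i' → i' ≤ i → j ≤ j' → j' ≤ b → IsTwoSeparator B (u i') (u j') →
        i' = i ∧ j' = j := by
  obtain ⟨hij, p, hp, hsep, harc, Z, ⟨⟨c, d, q, hq, hqb, rfl⟩, hmax⟩, hpZ, hpmax⟩ := h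
  have hlt' := hp.lt'
  have hin : IsInner q (u (i + 1)) :=
    ((hp.isInner_iff hF).2 ⟨i + 1, by omega, by omega, rfl⟩).of_toSubgraph_le harc.1 hq.1 hpZ
  have hcd : c ≠ d := by
    rintro rfl
    have := hq.1
    rw [Walk.isPath_iff_nil] at this
    cases q with
    | nil => exact hin.2.1 (by simpa using hin.1)
    | cons _ _ => simp at this
  rcases hq.segment_or hF hcd (fun v hv hvα => hqb v hv (mem_boundaryPoints_of_mem hvα)) with
    ⟨a, b, hab⟩ | ⟨-, -, hl⟩
  · have hle := (hp.toSubgraph_le_iff hF hab).1 hpZ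
    refine ⟨a, b, hle.1, hle.2, hab.lt', ?_, ?_, ?_⟩
    · exact fun m h1 h2 => hqb _ ((hab.isInner_iff hF).2 ⟨m, h1, h2, rfl⟩)
    · intro a' b' ha' hb' hb'n hno
      have hab' := hab.lt
      obtain ⟨q', hq', hs'⟩ := hF.exists_segment (show a' < b' by omega) hb'n
      have := hmax ⟨_, _, q', hq', fun v hv => by
        obtain ⟨m, h1, h2, rfl⟩ := (hs'.isInner_iff hF).1 hv
        exact hno m h1 h2, rfl⟩ ((hab.toSubgraph_le_iff hF hs').2 ⟨ha', hb'⟩)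
      have := (hs'.toSubgraph_le_iff hF hab).1 this
      omega
    · intro i' j' h1 h2 h3 h4 hs
      have hb := hab.lt'
      obtain ⟨p', hp', hps'⟩ := hF.exists_segment (show i' < j' by omega) (by omega)
      have := hpmax _ _ p' hs hp' ((hps'.toSubgraph_le_iff hF hab).2 ⟨h1, h4⟩)
      rw [lt_iff_le_not_ge, hp.toSubgraph_le_iff hF hps', hps'.toSubgraph_le_iff hF hp] at this
      omega
  · rcases (adj_toSubgraph_of_length_eq_one hl).2.1 _ hin.1 with h | h
    exacts [absurd h hin.2.1, absurd h hin.2.2]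

/-- A 2-separator of boundary vertices with no boundary point between them is covered by a maximal
one. -/
theorem IsFrame.exists_isMaxSegment [Finite V] (hF : E.IsFrame B n u α) {a b : ℕ}
    (hab : a + 2 ≤ b) (hb : b < n) (hsep : IsTwoSeparator B (u a) (u b))
    (hno : ∀ m, a < m → m < b → u m ∉ E.boundaryPoints B s t α) :
    ∃ i j, E.IsMaxSegment B n u s t α i j ∧ i ≤ a ∧ b ≤ j := by
  obtain ⟨p, hp, hps⟩ := hF.exists_segment (show a < b by omega) hb
  have hfin : Finite G.Subgraph := inferInstance
  -- By finiteness, first extend the path to a boundary part, then to a maximal separator path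
  -- within this part.
  obtain ⟨Z, hpZ, hZ⟩ := (Set.toFinite {Z' : G.Subgraph | ∃ (a b : V) (q : G.Walk a b),
    E.IsArc B q ∧ (∀ v, IsInner q v → v ∉ E.boundaryPoints B s t α) ∧
      Z' = q.toSubgraph}).exists_le_maximal (a := p.toSubgraph) ⟨_, _, p, hp, fun v hv => by
        obtain ⟨m, h1, h2, rfl⟩ := (hps.isInner_iff hF).1 hv
        exact hno m h1 h2, rfl⟩
  obtain ⟨T, hpT, hT⟩ := (Set.toFinite {T : G.Subgraph | ∃ (c d : V) (q : G.Walk c d),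
    IsTwoSeparator B c d ∧ E.IsArc B q ∧ q.toSubgraph ≤ Z ∧
      T = q.toSubgraph}).exists_le_maximal (a := p.toSubgraph) ⟨_, _, p, hsep, hp, hpZ, rfl⟩
  obtain ⟨⟨c, d, q, hqsep, hq, hqZ, rfl⟩, hmax⟩ := hT
  have hqmax : E.IsMaximalSeparator B s t α q := by
    refine ⟨hqsep, hq, Z, hZ, hqZ, fun c' d' p' h1 h2 h3 h4 => ?_⟩
    exact h4.not_ge (hmax ⟨_, _, p', h1, h2, h3, rfl⟩ h4.le)
  have hin : IsInner q (u (a + 1)) :=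
    ((hps.isInner_iff hF).2 ⟨a + 1, by omega, by omega, rfl⟩).of_toSubgraph_le hp.1 hq.1 hpT
  rcases hqmax.segment_or hF with ⟨i, j, hs⟩ | ⟨-, -, hl⟩
  · obtain ⟨h1, h2⟩ := (hps.toSubgraph_le_iff hF hs).1 hpT
    obtain rfl := hs.start
    obtain rfl := hs.finish
    exact ⟨i, j, ⟨by omega, q, hs, hqmax⟩, h1, h2⟩
  · rcases (adj_toSubgraph_of_length_eq_one hl).2.1 _ hin.1 with h | h
    exacts [absurd h hin.2.1, absurd h hin.2.2]

theorem IsPlusBridge.internal [Finite V] (hF : E.IsFrame B n u α) {c d : V} {p : G.Walk c d}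
    {i j : ℕ} (hp : IsSegment n u p i j) {J : G.Subgraph} (hJ : IsPlusBridge B p J) {z : V}
    (hz : z ∈ J.verts) (hzc : z ≠ c) (hzd : z ≠ d) :
    i + 2 ≤ j ∧ Linked B {c, d} (u (i + 1)) z := by
  have hlt := hp.lt
  have hlt' := hp.lt'
  have hij : i + 2 ≤ j := by
    by_contra hcon
    have hl := hp.length
    have := hJ.1.no_internal (hJ.2.2 (adj_toSubgraph_of_length_eq_one (p := p) (by omega)).1) hz
    tauto
  have hin := (hp.isInner_iff hF).2 ⟨i + 1, by omega, by omega, rfl⟩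
  have hmem : u (i + 1) ∈ J.verts := hJ.2.1 ((Walk.mem_verts_toSubgraph p).2 hin.1)
  exact ⟨hij, (hJ.1.internal_iff hmem hin.2.1 hin.2.2 z).1 ⟨hz, hzc, hzd⟩⟩

theorem IsSegment.exists_plusBridge [Finite V] (hF : E.IsFrame B n u α) {i j : ℕ}
    {p : G.Walk (u i) (u j)} (hp : IsSegment n u p i j) (hij : i + 2 ≤ j) :
    ∃ J, IsPlusBridge B p J ∧ ∀ z, Linked B {u i, u j} (u (i + 1)) z → z ∈ J.verts := by
  have hlt' := hp.lt'
  have h1 : u (i + 1) ∉ ({u i, u j} : Set V) :=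
    hF.notMem_pair (by omega) (by omega) (by omega) (by omega) (by omega)
  have hD : IsComponentSet (B.deleteVerts (edgelessOn G {u i, u j}).verts)
      {z | Linked B {u i, u j} (u (i + 1)) z} :=
    isComponentSet_deleteVerts_iff.2 ⟨u (i + 1), hF.mem_verts _, h1, rfl⟩
  have hlink : ∀ m, i < m → m < j → Linked B {u i, u j} (u (i + 1)) (u m) :=
    fun m h2 h3 => hF.linked_segment hlt' (by omega) h2 h3
  have hadj : ∀ m, i ≤ m → m < j →
      (incidentSubgraph B {z | Linked B {u i, u j} (u (i + 1)) z}).Adj (u m) (u (m + 1)) := by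
    intro m h2 h3
    refine ⟨hF.adj m, ?_⟩
    rcases h2.eq_or_lt with rfl | h2
    · exact Or.inr (hlink _ (by omega) (by omega))
    · exact Or.inl (hlink _ h2 h3)
  refine ⟨incidentSubgraph B {z | Linked B {u i, u j} (u (i + 1)) z},
    ⟨Or.inr ⟨_, hD, rfl⟩, ?_, ?_⟩, fun z hz => ⟨hz.mem_verts (hF.mem_verts _), Or.inl hz⟩⟩
  · intro x hx
    rw [Walk.mem_verts_toSubgraph, hp.mem_support] at hx
    obtain ⟨m, h2, h3, rfl⟩ := hx
    rcases h3.eq_or_lt with rfl | h3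
    · obtain ⟨k, rfl⟩ : ∃ k, m = k + 1 := ⟨m - 1, by omega⟩
      exact Subgraph.edge_vert _ (hadj k (by omega) (by omega)).symm
    · exact Subgraph.edge_vert _ (hadj m h2 h3)
  · intro x y hxy
    have hxy' : s(x, y) ∈ p.toSubgraph.edgeSet := hxy
    rw [Walk.mem_edges_toSubgraph, hp.mem_edges] at hxy'
    obtain ⟨m, h2, h3, h4⟩ := hxy'
    have := hadj m h2 h3
    rwa [← Subgraph.mem_edgeSet, ← h4] at this

/-- A separator whose path is a single edge has a trivial bridge there and deletes nothing.
Otherwise the internal vertices of the bridge form the component of `u (i + 1)`. -/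
theorem IsFrame.mem_splitVerts_iff [Finite V] (hF : E.IsFrame B n u α) {z : V} :
    z ∈ E.splitVerts B s t α ↔
      ∃ i j, E.IsMaxSegment B n u s t α i j ∧ Linked B {u i, u j} (u (i + 1)) z := by
  constructor
  · rintro ⟨c, d, p, J, hp, hJ, hz, hzc, hzd⟩
    rcases hp.segment_or hF with ⟨i, j, hs⟩ | ⟨-, -, hl⟩
    · obtain ⟨hij, hl⟩ := hJ.internal hF hs hz hzc hzd
      obtain rfl := hs.start
      obtain rfl := hs.finish
      exact ⟨i, j, ⟨hij, p, hs, hp⟩, hl⟩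
    · have := hJ.1.no_internal (hJ.2.2 (adj_toSubgraph_of_length_eq_one hl).1) hz
      tauto
  · rintro ⟨i, j, ⟨hij, p, hs, hp⟩, hl⟩
    obtain ⟨J, hJ, hmem⟩ := hs.exists_plusBridge hF hij
    have hlt' := hs.lt'
    have h1 := hl.notMem (hF.notMem_pair (by omega) (by omega) (by omega) (by omega) (by omega))
    exact ⟨_, _, p, J, hp, hJ, hmem z hl, by simpa using h1⟩

theorem IsFrame.mem_splitVerts_segment [Finite V] (hF : E.IsFrame B n u α) {m : ℕ} (hm : m < n)
    (h : u m ∈ E.splitVerts B s t α) : ∃ i j, E.IsMaxSegment B n u s t α i j ∧ i < m ∧ m < j := by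
  obtain ⟨i, j, hij, hl⟩ := hF.mem_splitVerts_iff.1 h
  exact ⟨i, j, hij, hF.lt_of_linked hij.lt.1 hij.lt.2 hij.sep hm hl⟩

theorem IsFrame.not_mem_splitVerts_of_mem_boundaryPoints [Finite V] (hF : E.IsFrame B n u α)
    {m : ℕ} (hm : m < n) (h : u m ∈ E.boundaryPoints B s t α) : u m ∉ E.splitVerts B s t α := by
  intro h'
  obtain ⟨i, j, ⟨-, p, hs, hp⟩, h1, h2⟩ := hF.mem_splitVerts_segment hm h'
  exact hp.not_mem_boundaryPoints ((hs.isInner_iff hF).2 ⟨m, h1, h2, rfl⟩) h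

end PlaneEmbedding

end Splitting

/-! ### The split graph is a block -/

section EtaBlock

variable {V : Type*}

theorem isBlock_of_linked {A : SimpleGraph V} {K : A.Subgraph} (h0 : K.verts.Nonempty)
    (h1 : ∀ x ∈ K.verts, ∀ y ∈ K.verts, Linked K ∅ x y)
    (h2 : ∀ v ∈ K.verts, ∀ x ∈ K.verts, x ≠ v → ∀ y ∈ K.verts, y ≠ v → Linked K {v} x y) :
    IsBlock K := by
  refine (isBlock_iff K).2 ⟨h0, h1, fun v x hx hxv y hy hyv => ?_⟩
  by_cases hv : v ∈ K.verts
  · exact h2 v hv x hx hxv y hy hyv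
  · refine (h1 x hx y hy).induct (P := Linked K {v} x) (Linked.refl x) ?_
    intro a b _ _ hab ih
    refine ih.trans (Linked.of_adj hab ?_ ?_)
    · rintro rfl
      exact hv (K.edge_vert hab)
    · rintro rfl
      exact hv (K.edge_vert hab.symm)

theorem isBlock_of_verts_subset_pair {A : SimpleGraph V} {K : A.Subgraph} {a b : V}
    (hv : ∀ x ∈ K.verts, x = a ∨ x = b) (hab : K.Adj a b) : IsBlock K := by
  have hne : a ≠ b := hab.ne
  refine isBlock_of_linked ⟨a, K.edge_vert hab⟩ ?_ ?_
  · intro x hx y hy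
    have h : Linked K ∅ a b := Linked.of_adj hab (by simp) (by simp)
    rcases hv x hx with rfl | rfl <;> rcases hv y hy with rfl | rfl
    exacts [Linked.refl _, h, h.symm, Linked.refl _]
  · intro v hv' x hx hxv y hy hyv
    have : x = y := by grind
    exact this ▸ Linked.refl _

namespace PlaneEmbedding

variable {G : SimpleGraph V} {E : PlaneEmbedding G} {B : G.Subgraph} {n : ℕ} {u : ℕ → V}
  {s t : V} {α : Sym2 V}

/-- Two overlapping maximal 2-separators cover the whole block, except for the ends of `α`. -/
theorem IsFrame.mem_splitVerts_of_crossing [Finite V] (hF : E.IsFrame B n u α) {i j i' j' : ℕ}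
    (h : E.IsMaxSegment B n u s t α i j) (h' : E.IsMaxSegment B n u s t α i' j') (h1 : i < i')
    (h2 : i' < j) (h3 : j < j') (hsep : ¬ IsTwoSeparator B (u i) (u j')) :
    ∀ x ∈ B.verts, x ∉ E.splitVerts B s t α → x = u 0 ∨ x = u (n - 1) := by
  have hl := h.lt
  have hl' := h'.lt
  have hjl : Linked B {u i', u j'} (u (i' + 1)) (u j) :=
    hF.linked_segment hl'.2 (by omega) (by omega) (by omega)
  have hil : Linked B {u i, u j} (u (i + 1)) (u i') :=
    hF.linked_segment hl.2 (by omega) (by omega) (by omega)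
  have hS : u (i + 1) ∉ ({u i, u j} : Set V) :=
    hF.notMem_pair (by omega) (by omega) (by omega) (by omega) (by omega)
  have hS' : u (i' + 1) ∉ ({u i', u j'} : Set V) :=
    hF.notMem_pair (by omega) (by omega) (by omega) (by omega) (by omega)
  have hne : u i ≠ u j' := fun h => by
    have := hF.eq_of_lt (by omega) (by omega) h
    omega
  -- Without `u i` and `u j'` the graph is connected and contains `u j`. The union of the two
  -- split-off components is closed under adjacency there, since each contains the end of the other
  -- separator at which a walk could leave it.
  have key : ∀ x ∈ B.verts, x ≠ u i → x ≠ u j' →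
      Linked B {u i, u j} (u (i + 1)) x ∨ Linked B {u i', u j'} (u (i' + 1)) x := by
    intro x hx hxi hxj
    have hlink : Linked B {u i, u j'} (u j) x := by
      by_contra hcon
      refine hsep ⟨hne, (isSeparator_iff _ _).2 ⟨?_, u j, hF.mem_verts j, ?_, x, hx, ?_, hcon⟩⟩
      · rintro _ (rfl | rfl)
        exacts [hF.mem_verts _, hF.mem_verts _]
      · exact hF.notMem_pair (by omega) (by omega) (by omega) (by omega) (by omega)
      · simp [hxi, hxj]
    refine hlink.induct (P := fun x => Linked B {u i, u j} (u (i + 1)) x ∨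
      Linked B {u i', u j'} (u (i' + 1)) x) (Or.inr hjl) ?_
    rintro a b ha hb hab (ih | ih)
    · by_cases hbj : b = u j
      · exact Or.inr (hbj ▸ hjl)
      · refine Or.inl (ih.trans (Linked.of_adj hab (ih.notMem hS) ?_))
        rintro (h | h)
        exacts [hb (Or.inl h), hbj h]
    · by_cases hbj : b = u i'
      · exact Or.inl (hbj ▸ hil)
      · refine Or.inr (ih.trans (Linked.of_adj hab (ih.notMem hS') ?_))
        rintro (h | h)
        exacts [hbj h, hb (Or.inr h)]
  -- Each component meets the boundary only inside its interval, so the two intervals exhaust the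
  -- boundary: `i = 0` and `j' = n - 1`.
  have hmem : ∀ m < n, m ≠ i → m ≠ j' → i < m ∧ m < j' := by
    intro m hm hmi hmj
    rcases key (u m) (hF.mem_verts m) (fun h => hmi (hF.eq_of_lt hm (by omega) h))
      (fun h => hmj (hF.eq_of_lt hm (by omega) h)) with hk | hk
    · have := hF.lt_of_linked hl.1 hl.2 h.sep hm hk
      omega
    · have := hF.lt_of_linked hl'.1 hl'.2 h'.sep hm hk
      omega
  have hi0 : i = 0 := by
    by_contra hne
    have := hmem 0 (by omega) (by omega) (by omega)
    omega
  have hjn : j' = n - 1 := by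
    by_contra hne
    have := hmem (n - 1) (by omega) (by omega) (by omega)
    omega
  subst hi0 hjn
  intro x hx hxs
  by_contra! hcon
  rcases key x hx hcon.1 hcon.2 with hk | hk
  · exact hxs (hF.mem_splitVerts_iff.2 ⟨_, _, h, hk⟩)
  · exact hxs (hF.mem_splitVerts_iff.2 ⟨_, _, h', hk⟩)

/-- A deleted end lies strictly inside another maximal interval. The two intervals overlap, so they
belong to the same boundary part. Nesting contradicts maximality; crossing makes their union a
non-separator, which is the degenerate alternative. -/
theorem IsFrame.ends_notMem_or [Finite V] (hF : E.IsFrame B n u α) :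
    (∀ i j, E.IsMaxSegment B n u s t α i j →
      u i ∉ E.splitVerts B s t α ∧ u j ∉ E.splitVerts B s t α) ∨
    ∀ x ∈ B.verts, x ∉ E.splitVerts B s t α → x = u 0 ∨ x = u (n - 1) := by
  by_contra! hcon
  obtain ⟨⟨i, j, hij, hs⟩, hdeg⟩ := hcon
  have hcross : ∀ i j i' j', E.IsMaxSegment B n u s t α i j → E.IsMaxSegment B n u s t α i' j' →
      i' < j → j < j' → ¬ i < i' := by
    intro i j i' j' h h' h2 h3 h1
    obtain ⟨x, hx, hxs, hxn⟩ := hdeg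
    have hl := h.lt
    have hl' := h'.lt
    obtain ⟨a, b, ha, hb, hbn, hno, hmax, hmax'⟩ := h.exists_part hF
    obtain ⟨a', b', ha', hb', hbn', hno', hmax₂, -⟩ := h'.exists_part hF
    have hno₂ : ∀ m, min a a' < m → m < max b b' → u m ∉ E.boundaryPoints B s t α := by
      intro m h1 h2
      by_cases hm : a < m ∧ m < b
      · exact hno m hm.1 hm.2
      · exact hno' m (by omega) (by omega)
    have e1 := hmax (min a a') (max b b') (by omega) (by omega) (by omega) hno₂
    have hsep : ¬ IsTwoSeparator B (u i) (u j') := by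
      intro hsep
      have := hmax' i j' (by omega) le_rfl (by omega) (by omega) hsep
      omega
    have := hF.mem_splitVerts_of_crossing h h' h1 h2 h3 hsep x hx hxs
    tauto
  have hnest : ∀ i j i' j', E.IsMaxSegment B n u s t α i j → E.IsMaxSegment B n u s t α i' j' →
      i ≤ i' → j' ≤ j → i' = i ∧ j' = j := by
    intro i j i' j' h h' h1 h2
    have hl := h.lt
    have hl' := h'.lt
    obtain ⟨a, b, ha, hb, hbn, hno, hmax, hmax'⟩ := h.exists_part hF
    obtain ⟨a', b', ha', hb', hbn', hno', hmax₂, hmax₂'⟩ := h'.exists_part hF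
    have hno₂ : ∀ m, min a a' < m → m < max b b' → u m ∉ E.boundaryPoints B s t α := by
      intro m h1 h2
      by_cases hm : a < m ∧ m < b
      · exact hno m hm.1 hm.2
      · exact hno' m (by omega) (by omega)
    have e1 := hmax₂ (min a a') (max b b') (by omega) (by omega) (by omega) hno₂
    have := hmax₂' i j (by omega) h1 h2 (by omega) h.sep
    omega
  have hl := hij.lt
  by_cases h : u i ∈ E.splitVerts B s t α
  · obtain ⟨a, b, hab, h1, h2⟩ := hF.mem_splitVerts_segment (by omega) h
    rcases le_or_gt j b with hjb | hjb
    · have := hnest a b i j hab hij (by omega) hjb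
      omega
    · exact hcross a b i j hab hij h2 hjb h1
  · obtain ⟨a, b, hab, h1, h2⟩ := hF.mem_splitVerts_segment (by omega) (hs h)
    rcases le_or_gt a i with hai | hai
    · have := hnest a b i j hab hij hai (by omega)
      omega
    · exact hcross i j a b hij hab h1 h2 hai

/-- Walks of `B` can be turned into walks of the split graph. -/
theorem IsFrame.linked_splitGraph [Finite V] (hF : E.IsFrame B n u α)
    (hN : ∀ i j, E.IsMaxSegment B n u s t α i j →
      u i ∉ E.splitVerts B s t α ∧ u j ∉ E.splitVerts B s t α)
    {S : Set V} {x y : V} (hx : x ∉ E.splitVerts B s t α) (hy : y ∉ E.splitVerts B s t α)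
    (h : Linked B S x y) : Linked (E.splitGraph B s t α) S x y := by
  -- Invariant along the walk: inside a split-off bridge, remember the end `e` through which it was
  -- entered. The walk can leave only at `u i` or `u j`, which is `e` itself or joined to it by the
  -- new edge.
  have key := h.induct (P := fun z =>
    (z ∉ E.splitVerts B s t α → Linked (E.splitGraph B s t α) S x z) ∧
    (z ∈ E.splitVerts B s t α → ∃ i j, E.IsMaxSegment B n u s t α i j ∧
      Linked B {u i, u j} (u (i + 1)) z ∧ ∃ e, (e = u i ∨ e = u j) ∧ e ∉ S ∧
        Linked (E.splitGraph B s t α) S x e))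
    ⟨fun _ => Linked.refl x, fun h => absurd h hx⟩ ?_
  · exact key.1 hy
  rintro a b ha hb hab ⟨ih1, ih2⟩
  by_cases has : a ∈ E.splitVerts B s t α
  · obtain ⟨i, j, hij, hl, e, he, heS, hxe⟩ := ih2 has
    have hlt := hij.lt
    obtain ⟨hi, hj⟩ := hN i j hij
    have hS : u (i + 1) ∉ ({u i, u j} : Set V) :=
      hF.notMem_pair (by omega) (by omega) (by omega) (by omega) (by omega)
    by_cases hbm : b = u i ∨ b = u j
    · have hbs : b ∉ E.splitVerts B s t α := by
        rcases hbm with rfl | rfl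
        exacts [hi, hj]
      refine ⟨fun _ => ?_, fun h => absurd h hbs⟩
      by_cases hbe : e = b
      · exact hbe ▸ hxe
      · refine hxe.trans (Linked.of_adj ⟨⟨?_, ?_⟩, ⟨B.edge_vert hab.symm, hbs⟩, hbe, Or.inr ?_⟩
          heS hb)
        · rcases he with rfl | rfl
          exacts [hF.mem_verts _, hF.mem_verts _]
        · rcases he with rfl | rfl
          exacts [hi, hj]
        · obtain ⟨-, p, -, hp⟩ := hij
          refine ⟨_, _, p, hp, ?_⟩
          rcases he with rfl | rfl <;> rcases hbm with rfl | rfl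
          exacts [absurd rfl hbe, rfl, Sym2.eq_swap, absurd rfl hbe]
    · have hlb := hl.trans (Linked.of_adj hab (hl.notMem hS) (y := b) (by simpa using hbm))
      have hbs : b ∈ E.splitVerts B s t α := hF.mem_splitVerts_iff.2 ⟨i, j, hij, hlb⟩
      exact ⟨fun h => absurd hbs h, fun _ => ⟨i, j, hij, hlb, e, he, heS, hxe⟩⟩
  · have hxa := ih1 has
    refine ⟨fun hbs => hxa.trans (Linked.of_adj ⟨⟨B.edge_vert hab, has⟩,
      ⟨B.edge_vert hab.symm, hbs⟩, hab.ne, Or.inl hab⟩ ha hb), fun hbs => ?_⟩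
    obtain ⟨i, j, hij, hl⟩ := hF.mem_splitVerts_iff.1 hbs
    have hlt := hij.lt
    have hS : u (i + 1) ∉ ({u i, u j} : Set V) :=
      hF.notMem_pair (by omega) (by omega) (by omega) (by omega) (by omega)
    refine ⟨i, j, hij, hl, a, ?_, ha, hxa⟩
    by_contra hcon
    exact has (hF.mem_splitVerts_iff.2 ⟨i, j, hij,
      hl.trans (Linked.of_adj hab.symm (hl.notMem hS) (by simpa using hcon))⟩)

theorem IsFrame.splitGraph_adj [Finite V] (hF : E.IsFrame B n u α) :
    (E.splitGraph B s t α).Adj (u (n - 1)) (u 0) := by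
  have hn := hF.two_le
  have h0 : u 0 ∉ E.splitVerts B s t α := hF.not_mem_splitVerts_of_mem_boundaryPoints (by omega)
    (mem_boundaryPoints_of_mem (by rw [hF.edge_eq]; simp))
  have h1 : u (n - 1) ∉ E.splitVerts B s t α :=
    hF.not_mem_splitVerts_of_mem_boundaryPoints (by omega)
      (mem_boundaryPoints_of_mem (by rw [hF.edge_eq]; simp))
  have hadj := hF.adj (n - 1)
  rw [Nat.sub_add_cancel (by omega), ← zero_add n, hF.periodic, zero_add] at hadj
  exact ⟨⟨hF.mem_verts _, h1⟩, ⟨hF.mem_verts _, h0⟩, hadj.ne, Or.inl hadj⟩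

theorem IsFrame.isBlock_splitGraph [Finite V] (hF : E.IsFrame B n u α) :
    IsBlock (E.splitGraph B s t α) := by
  rcases hF.ends_notMem_or (s := s) (t := t) with hN | hdeg
  · refine isBlock_of_linked ⟨_, (E.splitGraph B s t α).edge_vert hF.splitGraph_adj⟩ ?_ ?_
    · exact fun x hx y hy => hF.linked_splitGraph hN hx.2 hy.2 (hF.block.linked hx.1 hy.1)
    · exact fun v _ x hx hxv y hy hyv => hF.linked_splitGraph hN hx.2 hy.2
        (hF.block.linked_singleton hx.1 hxv hy.1 hyv)
  · exact isBlock_of_verts_subset_pair (fun x hx => (hdeg x hx.1 hx.2).symm) hF.splitGraph_adj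

theorem isBlock_edgeGraph (h : s ≠ t) : IsBlock (edgeGraph s t) :=
  isBlock_of_verts_subset_pair (a := s) (b := t) (fun _ hx => hx) ⟨h, rfl⟩

end PlaneEmbedding

end EtaBlock

/-! ### Attachments of bridges that meet the boundary -/

section OuterBridges

variable {V : Type*}

theorem exists_mem_support_ne {G : SimpleGraph V} {s t : V} {P : G.Walk s t} (hP : P.IsPath)
    {α : Sym2 V} (hα : α ∈ P.edges) (hne : P.edges ≠ [α]) (x y : V) :
    ∃ z ∈ P.support, z ≠ x ∧ z ≠ y := by
  classical
  by_contra! hcon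
  have h1 : P.support.toFinset ⊆ {x, y} := by
    intro z hz
    rw [List.mem_toFinset] at hz
    by_cases hzx : z = x
    · simp [hzx]
    · simp [hcon z hz hzx]
  have h2 := (Finset.card_le_card h1).trans Finset.card_le_two
  rw [List.toFinset_card_of_nodup hP.support_nodup, Walk.length_support, ← Walk.length_edges] at h2
  rcases hle : P.edges with _ | ⟨e, l⟩
  · rw [hle] at hα
    exact absurd hα List.not_mem_nil
  · rw [hle] at h2 hα hne
    have hl : l = [] := by
      rw [List.length_cons] at h2
      exact List.length_eq_zero_iff.1 (by omega)
    subst hl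
    rw [List.mem_singleton] at hα
    exact hne (hα ▸ rfl)

namespace PlaneEmbedding

variable {G : SimpleGraph V} {E : PlaneEmbedding G} {B : G.Subgraph} {n : ℕ} {u : ℕ → V}
  {s t : V} {α : Sym2 V}

theorem IsFrame.linked_range (hF : E.IsFrame B n u α) {S : Set V} {k m : ℕ} (hkm : k ≤ m)
    (h : ∀ l, k ≤ l → l ≤ m → u l ∉ S) : Linked B S (u k) (u m) := by
  induction m, hkm using Nat.le_induction with
  | base => exact Linked.refl _
  | succ m hkm ih =>
    exact (ih fun l h1 h2 => h l h1 (by omega)).trans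
      (Linked.of_adj (hF.adj m) (h m hkm (by omega)) (h _ (by omega) le_rfl))

theorem IsFrame.mem_outerVerts_iff [Finite V] (hF : E.IsFrame B n u α) {x : V} :
    x ∈ E.outerVerts B ↔ ∃ i < n, x = u i :=
  hF.toIsOuterCycle.mem_outerVerts_iff hF.conn hF.block

theorem IsArc.mem_outerVerts [Finite V] (hF : E.IsFrame B n u α) {c d : V} {p : G.Walk c d}
    (hp : E.IsArc B p) (hcd : c ≠ d) (hin : ∀ v, IsInner p v → v ∉ α) {x : V}
    (hx : x ∈ p.support) : x ∈ E.outerVerts B := by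
  have hn := hF.two_le
  rw [hF.mem_outerVerts_iff]
  rcases hp.segment_or hF hcd hin with ⟨i, j, hs⟩ | ⟨hc, hd, hl⟩
  · obtain ⟨m, h1, h2, h3⟩ := (hs.mem_support x).1 hx
    have := hs.lt'
    exact ⟨m, by omega, h3⟩
  · rcases (adj_toSubgraph_of_length_eq_one hl).2.1 x hx with rfl | rfl
    exacts [⟨n - 1, by omega, hc⟩, ⟨0, by omega, hd⟩]

/-- If `t` is not on the boundary, an enclosing point can be joined to `t` without using other
vertices of the boundary. -/
theorem IsFrame.linked_of_mem_enclosingPoints [Finite V] (hF : E.IsFrame B n u α)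
    (ht : t ∉ E.outerVerts B) {w : V} (hw : w ∈ E.enclosingPoints B s t α) {S : Set V}
    (hS : S ⊆ E.outerVerts B) (hwS : w ∉ S) : Linked B S w t := by
  obtain ⟨c, d, p, ⟨hsep, harc, ⟨J, hJ, htJ⟩, hin⟩, -, J₀, hJ₀, htJ₀, hwJ₀, hwp⟩ := hw
  have hin' : ∀ v, IsInner p v → v ∉ α := fun v hv => (hin v hv).2
  have hpo : ∀ x ∈ p.support, x ∈ E.outerVerts B :=
    fun x hx => harc.mem_outerVerts hF hsep.1 hin' hx
  have htp : t ∉ p.toSubgraph.verts := fun h => ht (hpo t ((Walk.mem_verts_toSubgraph p).1 h))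
  rcases hJ₀ with ⟨a, b, hab, ha, hb, -, rfl⟩ | ⟨D, hD, rfl⟩
  · have h1 : t = a ∨ t = b := htJ₀
    rcases h1 with rfl | rfl
    exacts [absurd ha htp, absurd hb htp]
  obtain ⟨v, hv, hvS, rfl⟩ := isComponentSet_deleteVerts_iff.1 hD
  have hvt := (mem_incidentSubgraph_iff hv hvS htp).1 htJ₀
  -- A boundary vertex joined to `t` off the path would lie in the same `{c, d}`-bridge as `t`,
  -- whose boundary vertices are all on the path.
  have hoff : ∀ x, Linked B p.toSubgraph.verts t x → x ∉ E.outerVerts B := by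
    intro x hx hxo
    have hxp := hx.notMem htp
    obtain ⟨m, hm, rfl⟩ := hF.mem_outerVerts_iff.1 hxo
    have htc : t ≠ c := fun h => htp (h ▸ (Walk.mem_verts_toSubgraph p).2 p.start_mem_support)
    have htd : t ≠ d := fun h => htp (h ▸ (Walk.mem_verts_toSubgraph p).2 p.end_mem_support)
    rcases harc.segment_or hF hsep.1 hin' with ⟨i, j, hs⟩ | ⟨-, -, hl⟩
    · obtain ⟨hij, hlink⟩ := hJ.internal hF hs htJ htc htd
      have hlink' : Linked B {c, d} t (u m) := hx.mono le_rfl (by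
        rintro _ (rfl | rfl)
        exacts [(Walk.mem_verts_toSubgraph p).2 p.start_mem_support,
          (Walk.mem_verts_toSubgraph p).2 p.end_mem_support])
      have hlt := hs.lt'
      obtain rfl := hs.start
      obtain rfl := hs.finish
      obtain ⟨h1, h2⟩ := hF.lt_of_linked hij hlt hsep hm (hlink.trans hlink')
      exact hxp ((Walk.mem_verts_toSubgraph p).2 ((hs.mem_support _).2 ⟨m, h1.le, h2.le, rfl⟩))
    · have := hJ.1.no_internal (hJ.2.2 (adj_toSubgraph_of_length_eq_one hl).1) htJ
      tauto
  have htS : ∀ x, Linked B p.toSubgraph.verts t x → Linked B S t x := by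
    intro x hx
    refine (hx.induct (P := fun x => Linked B p.toSubgraph.verts t x ∧ Linked B S t x)
      ⟨Linked.refl t, Linked.refl t⟩ ?_).2
    rintro a b ha hb hab ⟨ih1, ih2⟩
    have h1 := ih1.trans (Linked.of_adj hab ha hb)
    exact ⟨h1, ih2.trans (Linked.of_adj hab (fun h => hoff a ih1 (hS h))
      fun h => hoff b h1 (hS h))⟩
  obtain ⟨-, hw' | ⟨y, hy, hyw⟩⟩ := hwJ₀
  · exact absurd hwp (Linked.notMem hw' hvS)
  · have h1 : Linked B p.toSubgraph.verts t y := hvt.symm.trans hy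
    exact ((htS y h1).trans (Linked.of_adj hyw (fun h => hoff y h1 (hS h)) hwS)).symm

/-- A bridge of a path through `α` in the split graph that has an internal vertex on the boundary
has at least three attachments. -/
theorem IsFrame.two_lt_ncard_attachments [Finite V] (hF : E.IsFrame B n u α)
    (hN : ∀ i j, E.IsMaxSegment B n u s t α i j →
      u i ∉ E.splitVerts B s t α ∧ u j ∉ E.splitVerts B s t α)
    {P : (⊤ : SimpleGraph V).Walk s t} (hP : P.IsPath)
    (hle : P.toSubgraph ≤ E.splitGraph B s t α) (hα : α ∈ P.edges) (hne : P.edges ≠ [α])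
    {v : V} (hv : v ∈ (E.splitGraph B s t α).verts) (hvP : v ∉ P.toSubgraph.verts) {j : ℕ}
    (hj : j < n) (hvj : Linked (E.splitGraph B s t α) P.toSubgraph.verts v (u j)) :
    2 < (attachments P.toSubgraph (incidentSubgraph (E.splitGraph B s t α)
      {z | Linked (E.splitGraph B s t α) P.toSubgraph.verts v z})).ncard := by
  by_contra! hcard
  set η := E.splitGraph B s t α with hη
  set T := attachments P.toSubgraph (incidentSubgraph η {z | Linked η P.toSubgraph.verts v z})
    with hT
  have hTP : T ⊆ P.toSubgraph.verts := fun x hx => hx.2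
  have hsup : ∀ {x}, x ∈ P.support → x ∈ P.toSubgraph.verts :=
    fun h => (Walk.mem_verts_toSubgraph P).2 h
  -- A walk of `B` avoiding `T` turns into a walk of the split graph avoiding `T`, and the bridge
  -- can be left only through an attachment. So `T` separates the bridge from the rest even in `B`.
  have hclosed : ∀ x y, Linked η P.toSubgraph.verts v x → y ∈ η.verts → Linked B T x y →
      Linked η P.toSubgraph.verts v y := by
    intro x y hx hy hxy
    refine (hF.linked_splitGraph hN (hx.mem_verts hv).2 hy.2 hxy).induct
      (P := fun y => Linked η P.toSubgraph.verts v y) hx ?_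
    intro a b ha hb hab ih
    refine ih.trans (Linked.of_adj hab (ih.notMem hvP) fun h => hb ⟨⟨η.edge_vert hab.symm, ?_⟩, h⟩)
    exact Or.inr ⟨a, ih, hab⟩
  have hmemP : ∀ y, y ∈ P.toSubgraph.verts → ¬ Linked B T (u j) y :=
    fun y hy h => (hclosed _ y hvj (hle.1 hy) h).notMem hvP hy
  have hjP := hvj.notMem hvP
  rw [hF.edge_eq] at hα
  have h0P : u 0 ∈ P.toSubgraph.verts := hsup (P.snd_mem_support_of_mem_edges hα)
  have h1P : u (n - 1) ∈ P.toSubgraph.verts := hsup (P.fst_mem_support_of_mem_edges hα)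
  rw [← hF.edge_eq] at hα
  have hj0 : 0 < j := Nat.pos_of_ne_zero (by rintro rfl; exact hjP h0P)
  have hjn : j < n - 1 := by
    have : j ≠ n - 1 := by
      rintro rfl
      exact hjP h1P
    omega
  -- The nearest vertices of `P` on both sides of `u j`; they exist because `u 0` and `u (n - 1)`,
  -- the ends of `α`, are on `P`. They are attachments although the boundary path to them may be
  -- partly split off, since otherwise `hmemP` fails.
  obtain ⟨b, hjb, hbn, hbP, hb⟩ : ∃ b, j < b ∧ b < n ∧ u b ∈ P.toSubgraph.verts ∧
      ∀ m, j ≤ m → m < b → u m ∉ P.toSubgraph.verts := by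
    classical
    have hex : ∃ b, j < b ∧ u b ∈ P.toSubgraph.verts := ⟨n - 1, hjn, h1P⟩
    have hmin := Nat.find_min' hex ⟨hjn, h1P⟩
    refine ⟨Nat.find hex, (Nat.find_spec hex).1, by omega, (Nat.find_spec hex).2, ?_⟩
    intro m h1 h2 h3
    rcases h1.eq_or_lt with rfl | h1
    · exact hjP h3
    · exact Nat.find_min hex h2 ⟨h1, h3⟩
  obtain ⟨a, haj, haP, ha⟩ : ∃ a, a < j ∧ u a ∈ P.toSubgraph.verts ∧
      ∀ m, a < m → m ≤ j → u m ∉ P.toSubgraph.verts := by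
    classical
    have hex : ∃ k, k ≤ j ∧ u (j - k) ∈ P.toSubgraph.verts := ⟨j, le_rfl, by simpa using h0P⟩
    have hpos : Nat.find hex ≠ 0 := by
      intro h
      have := (Nat.find_spec hex).2
      rw [h] at this
      exact hjP this
    refine ⟨j - Nat.find hex, by omega, (Nat.find_spec hex).2, fun m h1 h2 h3 => ?_⟩
    refine Nat.find_min hex (m := j - m) (by omega) ⟨by omega, ?_⟩
    rwa [Nat.sub_sub_self h2]
  have hbT : u b ∈ T := by
    by_contra hbT
    refine hmemP _ hbP (hF.linked_range hjb.le fun l h1 h2 h3 => ?_)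
    rcases h2.eq_or_lt with rfl | h2
    exacts [hbT h3, hb l h1 h2 (hTP h3)]
  have haT : u a ∈ T := by
    by_contra haT
    refine hmemP _ haP (hF.linked_range haj.le fun l h1 h2 h3 => ?_).symm
    rcases h1.eq_or_lt with rfl | h1
    exacts [haT h3, ha l h1 h2 (hTP h3)]
  have hab : u a ≠ u b := fun h => by
    have := hF.eq_of_lt (by omega) hbn h
    omega
  have hTeq : T = {u a, u b} := by
    refine (Set.eq_of_subset_of_ncard_le ?_ ?_ (Set.toFinite _)).symm
    · rintro _ (rfl | rfl)
      exacts [haT, hbT]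
    · rwa [Set.ncard_pair hab]
  have hlink : ∀ m, a < m → m < b → Linked B T (u j) (u m) := by
    intro m h1 h2
    rw [hTeq]
    exact (hF.linked_segment hbn (k := a + 1) (by omega) (by omega) hjb).symm.trans
      (hF.linked_segment hbn (k := a + 1) (by omega) (by omega) h2)
  -- As `P` is not just `α`, it has a vertex other than the two attachments, which they separate
  -- from `u j`.
  obtain ⟨z, hz, hza, hzb⟩ := exists_mem_support_ne hP hα hne (u a) (u b)
  have hsep : IsTwoSeparator B (u a) (u b) := by
    refine ⟨hab, (isSeparator_iff _ _).2 ⟨?_, u j, hF.mem_verts j, ?_, z, (hle.1 (hsup hz)).1, ?_,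
      ?_⟩⟩
    · rintro _ (rfl | rfl)
      exacts [hF.mem_verts _, hF.mem_verts _]
    · exact hF.notMem_pair (by omega) hbn hj (by omega) (by omega)
    · simp [hza, hzb]
    · exact hTeq ▸ hmemP z (hsup hz)
  -- A boundary point between them survives the splitting, so it is internal to the bridge. But `s`,
  -- the ends of `α` and `t` are on `P`, and an enclosing point would join the bridge to `t`
  -- avoiding `T`.
  have hno : ∀ m, a < m → m < b → u m ∉ E.boundaryPoints B s t α := by
    intro m h1 h2 h3
    have hms := hF.not_mem_splitVerts_of_mem_boundaryPoints (by omega) h3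
    have hmD := hclosed _ _ hvj ⟨hF.mem_verts m, hms⟩ (hlink m h1 h2)
    have hmP := hmD.notMem hvP
    rcases h3 with (h3 | h3) | h3
    · exact hmP (hsup (h3 ▸ P.start_mem_support))
    · rw [hF.edge_eq, Sym2.mem_iff] at h3
      rcases h3 with h3 | h3
      exacts [hmP (h3 ▸ h1P), hmP (h3 ▸ h0P)]
    · split_ifs at h3 with ht
      · rw [Set.mem_singleton_iff] at h3
        exact hmP (hsup (h3 ▸ P.end_mem_support))
      · refine hmemP t (hsup P.end_mem_support) ((hlink m h1 h2).trans
          (hF.linked_of_mem_enclosingPoints ht h3 ?_ fun h => hmP (hTP h)))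
        rw [hTeq]
        rintro _ (rfl | rfl)
        · exact hF.mem_outerVerts_iff.2 ⟨a, by omega, rfl⟩
        · exact hF.mem_outerVerts_iff.2 ⟨b, by omega, rfl⟩
  -- The separator is covered by a maximal one, so `u j` was split off and is not in the split graph
  -- at all.
  obtain ⟨i, j', hij, h1, h2⟩ := hF.exists_isMaxSegment (by omega) hbn hsep hno
  refine (hvj.mem_verts hv).2 (hF.mem_splitVerts_iff.2 ⟨i, j', hij, ?_⟩)
  exact hF.linked_segment hij.lt.2 (by omega) (by omega) (by omega)

end PlaneEmbedding

end OuterBridges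

/-! ### The interior of a block, the exceptional case and the theorem -/

section Main

variable {V : Type*}

theorem IsBlock.preconnected {G : SimpleGraph V} (h : IsBlock (⊤ : G.Subgraph)) :
    G.Preconnected := by
  intro x y
  refine (h.linked (Set.mem_univ x) (Set.mem_univ y)).induct (P := fun z => G.Reachable x z)
    (Reachable.refl x) ?_
  intro a b _ _ hab ih
  exact ih.trans (Adj.reachable hab)

namespace PlaneEmbedding

variable {G : SimpleGraph V} {E : PlaneEmbedding G} {B : G.Subgraph} {n : ℕ} {u : ℕ → V}
  {s t : V} {α : Sym2 V}

theorem IsFrame.exists_of_mem_outerEdges [Finite V] (hG : G.Preconnected) (hB : IsBlock B)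
    (hα : α ∈ E.outerEdges B) : ∃ n u, E.IsFrame B n u α := by
  obtain ⟨a, ha, rfl⟩ := hα
  obtain ⟨n, u, hC, h1, h2⟩ := E.exists_isOuterCycle hG hB ha
  exact ⟨n, u, hC, hG, hB, by rw [h1, h2]; rfl⟩

theorem eq_outer_of_mem_outerEdges_top {e : Sym2 V} (he : e ∈ E.outerEdges (⊤ : G.Subgraph)) :
    ∃ d : G.Dart, d.edge = e ∧ E.face d = E.outer := by
  obtain ⟨d, ⟨-, hd⟩, rfl⟩ := he
  refine ⟨d, rfl, ?_⟩
  generalize E.face d = F at hd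
  induction hd with
  | refl => rfl
  | tail _ h _ =>
    obtain ⟨d', hd', -⟩ := h
    exact absurd d'.edge_mem (by simp at hd')

/-- The vertices on the boundary of the outer face of `G`. -/
def OnOuterFace (E : PlaneEmbedding G) (q : V) : Prop :=
  ∃ d : G.Dart, (d.fst = q ∨ d.snd = q) ∧ E.face d = E.outer

theorem onOuterFace_of_mem {e : Sym2 V} (he : e ∈ E.outerEdges (⊤ : G.Subgraph)) {q : V}
    (hq : q ∈ e) : E.OnOuterFace q := by
  obtain ⟨d, rfl, hd⟩ := eq_outer_of_mem_outerEdges_top he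
  refine ⟨d, ?_, hd⟩
  rcases Sym2.mem_iff.1 (show q ∈ s(d.fst, d.snd) from hq) with h | h
  exacts [Or.inl h.symm, Or.inr h.symm]

theorem onOuterFace_of_mem_arc {x l q : V} {Q : G.Walk x l} (hQ : E.IsArc ⊤ Q)
    (hl : E.OnOuterFace l) (hq : q ∈ Q.support) : E.OnOuterFace q := by
  rcases eq_or_ne q l with rfl | hne
  · exact hl
  obtain ⟨-, hd⟩ := hQ
  induction Q with
  | nil =>
    rw [Walk.support_nil, List.mem_singleton] at hq
    exact absurd hq hne
  | @cons a b c h p ih =>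
    simp only [Walk.darts_cons, List.mem_cons, forall_eq_or_imp] at hd
    rw [Walk.support_cons, List.mem_cons] at hq
    rcases hq with rfl | hq
    · exact onOuterFace_of_mem ⟨_, hd.1, rfl⟩ (Sym2.mem_mk_left _ _)
    · exact ih hl hq hne hd.2

/-- Vertices inside the boundary cycle of `B`, and those reachable from them, are not on the outer
face. -/
theorem IsFrame.not_onOuterFace [Finite V] (hF : E.IsFrame B n u α) (hn : 3 ≤ n) {v w z : V}
    (hv : v ∈ B.verts) (hvu : v ∉ Set.range u) (hvw : G.Adj v w)
    (hwz : Linked (⊤ : G.Subgraph) B.verts w z) (hw : w ∉ B.verts) : ¬ E.OnOuterFace z := by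
  -- Colour 1 holds around `v` and is passed on along walks that avoid the cycle, while the outer
  -- face has colour 0.
  obtain ⟨f, h0, hoff, h1⟩ := hF.exists_inner_colouring hF.conn hF.block hn
  have hnot : ∀ {y}, y ∉ B.verts → y ∉ Set.range u := by
    rintro y hy ⟨i, rfl⟩
    exact hy (hF.mem_verts i)
  have hconst : ∀ {y}, y ∉ Set.range u → ∀ d d' : G.Dart, d.fst = y → d'.fst = y →
      f (E.face d) = f (E.face d') := fun hy d d' hd hd' =>
    E.colour_eq_of_fst_eq f (fun d hd => hoff d (hd ▸ hy)) hd hd'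
  have hstep : ∀ {a b}, a ∉ Set.range u → b ∉ Set.range u → G.Adj a b →
      (∀ d : G.Dart, d.fst = a → f (E.face d) = 1) → ∀ d : G.Dart, d.fst = b →
        f (E.face d) = 1 := by
    intro a b ha hb hab h d hd
    rw [hconst hb d (Dart.symm ⟨(a, b), hab⟩) hd rfl, ← hoff ⟨(a, b), hab⟩ ha]
    exact h _ rfl
  have hv1 : ∀ d : G.Dart, d.fst = v → f (E.face d) = 1 := by
    intro d hd
    have hne : v ≠ u 0 := fun h => hvu ⟨0, h.symm⟩
    obtain ⟨y, -, hy⟩ := (hF.block.linked hv (hF.mem_verts 0)).exists_adj hne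
    rw [hconst hvu d ⟨(v, y), B.adj_sub hy⟩ hd rfl]
    exact h1 _ hy fun i hi => absurd ⟨i, hi.symm⟩ hvu
  have hz := hwz.induct (P := fun y => y ∉ B.verts ∧ ∀ d : G.Dart, d.fst = y → f (E.face d) = 1)
    ⟨hw, hstep hvu (hnot hw) hvw hv1⟩
    fun a b _ hb hab ih => ⟨hb, hstep (hnot ih.1) (hnot hb) hab ih.2⟩
  rintro ⟨d, hd, hdo⟩
  have hd0 : f (E.face d) = 0 := h0 _ (hdo ▸ Relation.ReflTransGen.refl)
  rcases hd with hd | hd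
  · rw [hz.2 d hd] at hd0
    exact one_ne_zero hd0
  · have h2 := hz.2 d.symm hd
    rw [← Dart.symm_symm d, ← hoff d.symm (by rw [← hd] at hz; exact hnot hz.1), h2] at hd0
    exact one_ne_zero hd0

theorem IsFrame.mem_range_of_onOuterFace [Finite V] (hF : E.IsFrame B n u α) {v : V}
    (hv : v ∈ B.verts) (hn : 3 ≤ n) (ho : E.OnOuterFace v) : v ∈ Set.range u := by
  by_contra hvu
  obtain ⟨f, h0, hoff, h1⟩ := hF.exists_inner_colouring hF.conn hF.block hn
  have hne : v ≠ u 0 := fun h => hvu ⟨0, h.symm⟩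
  obtain ⟨y, -, hy⟩ := (hF.block.linked hv (hF.mem_verts 0)).exists_adj hne
  have h2 := h1 ⟨(v, y), B.adj_sub hy⟩ hy fun i hi => absurd ⟨i, hi.symm⟩ hvu
  have hconst : ∀ d d' : G.Dart, d.fst = v → d'.fst = v → f (E.face d) = f (E.face d') :=
    fun d d' hd hd' => E.colour_eq_of_fst_eq f (fun d hd => hoff d (hd ▸ hvu)) hd hd'
  obtain ⟨d, hd, hdo⟩ := ho
  have hd0 : f (E.face d) = 0 := h0 _ (hdo ▸ Relation.ReflTransGen.refl)
  rcases hd with hd | hd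
  · rw [hconst d ⟨(v, y), B.adj_sub hy⟩ hd rfl, h2] at hd0
    exact one_ne_zero hd0
  · rw [← Dart.symm_symm d, ← hoff d.symm (by rw [← hd] at hvu; exact hvu),
      hconst d.symm ⟨(v, y), B.adj_sub hy⟩ hd rfl, h2] at hd0
    exact one_ne_zero hd0

/-- If `B` is a block of `G - Q`, where `G` is 2-connected and `Q` is on the outer face, then the
inside of the boundary cycle of `B` is not attached to anything outside of `B`. -/
theorem IsFrame.adj_of_interior [Finite V] (hF : E.IsFrame B n u α) (hn : 3 ≤ n)
    (hG : IsBlock (⊤ : G.Subgraph)) {Q : Set V} (hQ : ∀ q ∈ Q, E.OnOuterFace q)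
    (hB : IsBlockOf B ((⊤ : G.Subgraph).deleteVerts Q)) {v w : V} (hv : v ∈ B.verts)
    (hvu : v ∉ Set.range u) (hvw : G.Adj v w) : B.Adj v w := by
  -- If `w` is outside `B`, add its whole component of `G - B`. It lies inside the cycle and hence
  -- avoids `Q`, and since `G` has no 1-separator the enlarged graph is again a block, so maximality
  -- of `B` gives `w ∈ B`.
  let X : Set V := B.verts ∪ {z | Linked (⊤ : G.Subgraph) B.verts w z}
  let B' : G.Subgraph := (⊤ : G.Subgraph).induce X
  have hX : ∀ z ∈ X, z ∉ B.verts → w ∉ B.verts ∧ Linked (⊤ : G.Subgraph) B.verts w z := by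
    rintro z (hz | hz) hzB
    · exact absurd hz hzB
    · exact ⟨hz.symm.notMem hzB, hz⟩
  have hBB' : B ≤ B' := by
    refine ⟨fun z hz => Or.inl hz, fun a b hab => ?_⟩
    exact ⟨Or.inl (B.edge_vert hab), Or.inl (B.edge_vert hab.symm), B.adj_sub hab⟩
  have hB'H : B' ≤ (⊤ : G.Subgraph).deleteVerts Q := by
    have hXQ : ∀ z ∈ X, z ∉ Q := by
      intro z hz hzQ
      by_cases hzB : z ∈ B.verts
      · exact (hB.prop.1.1 hzB).2 hzQ
      · obtain ⟨hw, hwz⟩ := hX z hz hzB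
        exact hF.not_onOuterFace hn hv hvu hvw hwz hw (hQ z hzQ)
    refine ⟨fun z hz => ⟨Set.mem_univ z, hXQ z hz⟩, ?_⟩
    rintro a b ⟨ha, hb, hab⟩
    rw [Subgraph.deleteVerts_adj]
    exact ⟨Set.mem_univ a, hXQ a ha, Set.mem_univ b, hXQ b hb, hab⟩
  have hreach : ∀ S : Set V, (∀ x y, x ∉ S → y ∉ S → Linked (⊤ : G.Subgraph) S x y) →
      (∀ x ∈ B.verts, ∀ y ∈ B.verts, x ∉ S → y ∉ S → Linked B S x y) →
      (∃ b ∈ B.verts, b ∉ S) → ∀ x ∈ X, x ∉ S → ∀ y ∈ X, y ∉ S → Linked B' S x y := by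
    rintro S hGS hBS ⟨b, hb, hbS⟩
    have hto : ∀ x ∈ X, x ∉ S → Linked B' S x b := by
      intro x hx hxS
      by_cases hxB : x ∈ B.verts
      · exact (hBS x hxB b hb hxS hbS).mono hBB' le_rfl
      · have key := (hGS x b hxS hbS).induct (P := fun y =>
          (y ∉ B.verts ∧ y ∈ X ∧ Linked B' S x y) ∨
            ∃ b' ∈ B.verts, b' ∉ S ∧ Linked B' S x b') (Or.inl ⟨hxB, hx, Linked.refl x⟩) ?_
        · rcases key with h | ⟨b', hb', hb'S, h⟩
          · exact absurd hb h.1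
          · exact h.trans ((hBS b' hb' b hb hb'S hbS).mono hBB' le_rfl)
        · rintro a c haS hcS hac (⟨haB, haX, hxa⟩ | h)
          · by_cases hcB : c ∈ B.verts
            · exact Or.inr ⟨c, hcB, hcS, hxa.trans
                (Linked.of_adj ⟨haX, Or.inl hcB, hac⟩ haS hcS)⟩
            · have hcX : c ∈ X :=
                Or.inr ((hX a haX haB).2.trans (Linked.of_adj hac haB hcB))
              exact Or.inl ⟨hcB, hcX, hxa.trans (Linked.of_adj ⟨haX, hcX, hac⟩ haS hcS)⟩
          · exact Or.inr h
    exact fun x hx hxS y hy hyS => (hto x hx hxS).trans (hto y hy hyS).symm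
  have hblock : IsBlock B' := by
    refine isBlock_of_linked ⟨v, Or.inl hv⟩ (fun x hx y hy => ?_)
      (fun z _ x hx hxz y hy hyz => ?_)
    · exact hreach ∅ (fun x y _ _ => hG.linked (Set.mem_univ x) (Set.mem_univ y))
        (fun x hx y hy _ _ => hF.block.linked hx hy) ⟨v, hv, by simp⟩ x hx (by simp) y hy (by simp)
    · refine hreach {z}
        (fun x y hx hy => hG.linked_singleton (Set.mem_univ x) hx (Set.mem_univ y) hy)
        (fun x hx y hy hxz hyz => hF.block.linked_singleton hx hxz hy hyz) ?_ x hx hxz y hy hyz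
      by_cases hz : z = u 0
      · exact ⟨u 1, hF.mem_verts 1, fun h => (hF.adj 0).ne (hz.symm.trans h.symm)⟩
      · exact ⟨u 0, hF.mem_verts 0, fun h => hz h.symm⟩
  have hmax := hB.2 ⟨hB'H, hblock⟩ hBB'
  refine hmax.2 ⟨Or.inl hv, ?_, hvw⟩
  by_cases hw : w ∈ B.verts
  · exact Or.inl hw
  · exact Or.inr (Linked.refl w)

/-- The only case in which `C_η(B)` is not obtained by replacing paths with edges. -/
theorem IsFrame.isMaxSegment_of_closing [Finite V] (hF : E.IsFrame B n u α) {c d : V}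
    {p : G.Walk c d} (hp : E.IsMaximalSeparator B s t α p) (ho : s(c, d) ∈ E.outerEdges B)
    (hpe : s(c, d) ∉ p.edges) : E.IsMaxSegment B n u s t α 0 (n - 1) := by
  rcases hp.segment_or hF with ⟨i, j, hs⟩ | ⟨-, -, hl⟩
  · obtain ⟨o, ho, hoe⟩ := ho
    obtain ⟨k, hk, h1, h2⟩ := hF.complete hF.conn hF.block ho
    have hlt := hs.lt
    have hlt' := hs.lt'
    have hoe' : s(o.fst, o.snd) = s(c, d) := hoe
    obtain rfl := hs.start
    obtain rfl := hs.finish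
    rw [h1, h2] at hoe'
    have hij : j ≠ i + 1 := by
      rintro rfl
      exact hpe ((hs.mem_edges _).2 ⟨i, le_rfl, by omega, rfl⟩)
    have hpos : i = 0 ∧ j = n - 1 := by
      rcases Sym2.eq_iff.1 hoe' with ⟨h3, h4⟩ | ⟨h3, h4⟩
      · have := hF.eq_of_lt hk (by omega) h3
        subst this
        have := hF.eq_of_lt (by omega) (by omega) h4
        omega
      · have := hF.eq_of_lt hk (by omega) h3
        subst this
        by_cases hkn : k + 1 < n
        · have := hF.eq_of_lt hkn (by omega) h4
          omega
        · have hkn' : k + 1 = 0 + n := by omega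
          rw [hkn', hF.periodic] at h4
          have := hF.eq_of_lt (by omega) (by omega) h4
          omega
    obtain ⟨rfl, rfl⟩ := hpos
    exact ⟨by omega, p, hs, hp⟩
  · rw [(adj_toSubgraph_of_length_eq_one hl).2.2] at hpe
    simp at hpe

/-- If the whole boundary except for `α` is split off, then by the indecomposability of `G` only a
triangle remains. -/
theorem IsFrame.eq_of_notMem_splitVerts [Finite V] (hF : E.IsFrame B n u α)
    (hmax : E.IsMaxSegment B n u s t α 0 (n - 1))
    (hadj : ∀ v w, v ∈ B.verts → v ∉ Set.range u → G.Adj v w → B.Adj v w) {l r : V}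
    (hlr : G.Adj l r) (hl : l ∉ B.verts) (htB : t ∈ B.verts)
    (hts : t ∉ E.splitVerts B s t α) (hy : ¬ IsDecomposable G t s(l, r)) {x : V}
    (hx : x ∈ B.verts) (hxs : x ∉ E.splitVerts B s t α) : x = t ∨ x = u 0 ∨ x = u (n - 1) := by
  have hlt := hmax.lt
  have hne : u 0 ≠ u (n - 1) := hmax.sep.1
  let I : Set V := {z | Linked B {u 0, u (n - 1)} (u 1) z}
  have hIs : ∀ {z}, z ∉ E.splitVerts B s t α → z ∉ I := fun hz hzI =>
    hz (hF.mem_splitVerts_iff.2 ⟨_, _, hmax, hzI⟩)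
  have h1 : u 1 ∉ ({u 0, u (n - 1)} : Set V) :=
    hF.notMem_pair (by omega) (by omega) (by omega) (by omega) (by omega)
  have h0I : u 0 ∉ I := fun h => Linked.notMem h h1 (Or.inl rfl)
  have hnI : u (n - 1) ∉ I := fun h => Linked.notMem h h1 (Or.inr rfl)
  have huI : ∀ i, u i ∉ I → u i = u 0 ∨ u i = u (n - 1) := by
    intro i hi
    rw [← hF.mod i] at hi ⊢
    have hin := Nat.mod_lt i (show 0 < n by omega)
    by_contra! hcon
    have e0 : i % n ≠ 0 := fun h => hcon.1 (by rw [h])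
    have e1 : i % n ≠ n - 1 := fun h => hcon.2 (by rw [h])
    exact hi (hF.linked_segment (i := 0) (j := n - 1) (k := 1) (by omega) (by omega) (by omega)
      (by omega))
  -- One side is `B` without the split-off component; the other is everything else together with `u
  -- 0` and `u (n - 1)`. Other vertices of `LV` are inside the cycle, so all their neighbours are in
  -- `B`, and none is in `I`.
  let LV : Set V := B.verts \ I
  let RV : Set V := {z | z ∈ LV → z = u 0 ∨ z = u (n - 1)}
  have h0L : u 0 ∈ LV := ⟨hF.mem_verts _, h0I⟩
  have hnL : u (n - 1) ∈ LV := ⟨hF.mem_verts _, hnI⟩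
  have hside : ∀ a b, G.Adj a b → a ∈ LV → ¬ (a = u 0 ∨ a = u (n - 1)) → b ∈ LV := by
    intro a b hab ha hna
    have hau : a ∉ Set.range u := by
      rintro ⟨i, rfl⟩
      exact hna (huI i ha.2)
    have hBab := hadj a b ha.1 hau hab
    refine ⟨B.edge_vert hBab.symm, fun hb => ha.2 ?_⟩
    exact Linked.trans hb (Linked.of_adj hBab.symm (Linked.notMem hb h1) hna)
  by_contra! hcon
  refine hy ⟨(⊤ : G.Subgraph).induce LV, (⊤ : G.Subgraph).induce RV, u 0, u (n - 1), hne,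
    ?_, ?_, ⟨htB, hIs hts⟩, ?_, ?_, ?_⟩
  · refine top_le_iff.1 ⟨fun z _ => ?_, fun a b hab => ?_⟩
    · by_cases hz : z ∈ LV
      · exact Or.inl hz
      · exact Or.inr fun h => absurd h hz
    · have hab' : G.Adj a b := hab
      by_cases ha : a ∈ RV
      · by_cases hb : b ∈ RV
        · exact Or.inr ⟨ha, hb, hab⟩
        · simp only [RV, Set.mem_ofPred_eq, Classical.not_imp] at hb
          exact Or.inl ⟨hside b a hab'.symm hb.1 hb.2, hb.1, hab⟩
      · simp only [RV, Set.mem_ofPred_eq, Classical.not_imp] at ha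
        exact Or.inl ⟨ha.1, hside a b hab' ha.1 ha.2, hab⟩
  · ext z
    constructor
    · rintro ⟨hzL, hzR⟩
      exact hzR hzL
    · rintro (rfl | rfl)
      exacts [⟨h0L, fun _ => Or.inl rfl⟩, ⟨hnL, fun _ => Or.inr rfl⟩]
  · have hlL : l ∉ LV := fun h => hl h.1
    refine ⟨fun h => absurd h hlL, fun hrL => ?_, hlr⟩
    by_contra hr
    exact hlL (hside r l hlr.symm hrL hr)
  · intro h
    have hxL : x ∈ LV := ⟨hx, hIs hxs⟩
    have : x ∈ ({t, u 0, u (n - 1)} : Set V) := h ▸ hxL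
    rcases this with h | h | h
    exacts [hcon.1 h, hcon.2.1 h, hcon.2.2 h]
  · intro h
    have hlR : l ∈ RV := fun h' => absurd h'.1 hl
    have : l ∈ ({u 0, u (n - 1)} : Set V) := h ▸ hlR
    rcases this with rfl | rfl
    exacts [hl (hF.mem_verts _), hl (hF.mem_verts _)]

/-- Outside the exceptional case `C_η(B)` has only vertices of `C_B`. In that case it is the
boundary of a smaller plane graph and may run through the interior of `C_B`. -/
theorem IsFrame.exists_eq_of_mem_etaOuterEdges [Finite V] (hF : E.IsFrame B n u α)
    (hα : α ≠ s(s, t)) (hmax : ¬ E.IsMaxSegment B n u s t α 0 (n - 1)) {e : Sym2 V}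
    (he : e ∈ E.etaOuterEdges B s t α) {x : V} (hx : x ∈ e) : ∃ m < n, x = u m := by
  have hn := hF.two_le
  rw [etaOuterEdges, if_neg hα, if_neg] at he
  · rcases he with ⟨he, -⟩ | ⟨c, d, p, hp, rfl⟩
    · exact hF.mem_outerVerts_iff.1 ⟨e, he, hx⟩
    · have hxp : x ∈ p.support := by
        rcases Sym2.mem_iff.1 hx with rfl | rfl
        exacts [p.start_mem_support, p.end_mem_support]
      exact hF.mem_outerVerts_iff.1 (hp.2.1.mem_outerVerts hF hp.1.1
        (fun v hv hvα => hp.not_mem_boundaryPoints hv (mem_boundaryPoints_of_mem hvα)) hxp)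
  · rintro ⟨c, d, p, hp, ho, hpe⟩
    exact hmax (hF.isMaxSegment_of_closing hp ho hpe)

end PlaneEmbedding

theorem IsBlock.exists_adj_of_adj {A : SimpleGraph V} {K : A.Subgraph} (h : IsBlock K) {a b z : V}
    (hab : K.Adj a b) (hz : z ∈ K.verts) : ∃ w, K.Adj z w := by
  by_cases hza : z = a
  · exact ⟨b, hza ▸ hab⟩
  · obtain ⟨w, -, hw⟩ := (h.linked hz (K.edge_vert hab)).exists_adj hza
    exact ⟨w, hw⟩

end Main

theorem mainTheorem7 {V : Type*} [Finite V] (G : SimpleGraph V) (E : PlaneEmbedding G)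
    (hG : IsTwoConnected (⊤ : G.Subgraph))
    (x y l r : V) (hα : s(l, r) ∈ E.outerEdges ⊤)
    (Q : G.Walk x l) (hQ : E.IsArc ⊤ Q) (hr : r ∉ Q.support)
    (hyQ : y ∉ Q.support) (hyr : y ≠ r)
    (hx : ¬ PlaneEmbedding.IsDecomposable G x s(l, r))
    (hy : ¬ PlaneEmbedding.IsDecomposable G y s(l, r))
    (hJ : ¬ E.HasIsolatedBridge x y s(l, r))
    (k : ℕ) (B : Fin (k + 1) → G.Subgraph) (v : Fin (k + 2) → V)
    (hK : E.IsBlockChain ((⊤ : G.Subgraph).deleteVerts {u | u ∈ Q.support}) r y s(l, r) B v)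
    (α : Fin (k + 1) → Sym2 V) (hα' : ∀ i, α i ∈ E.outerEdges (B i)) (i : Fin (k + 1)) :
    IsBlock (E.eta (B i) (v i.castSucc) (v i.succ) (α i)) ∧
    ∀ P : (⊤ : SimpleGraph V).Walk (v i.castSucc) (v i.succ),
      IsTuttePathThrough (E.eta (B i) (v i.castSucc) (v i.succ) (α i))
        (E.etaOuterEdges (B i) (v i.castSucc) (v i.succ) (α i)) (α i) P →
      P.edges ≠ [α i] →
      ∀ J, IsBridgeOf (E.eta (B i) (v i.castSucc) (v i.succ) (α i)) P.toSubgraph J →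
        IsOuterBridge (E.etaOuterEdges (B i) (v i.castSucc) (v i.succ) (α i)) J →
        IsTrivialBridge J := by
  have hblock : ∀ i, IsBlock (B i) := fun i => (hK.isBlockOf i).prop.2
  have hconn := hG.2.preconnected
  obtain ⟨n, u, hF⟩ := PlaneEmbedding.IsFrame.exists_of_mem_outerEdges hconn (hblock i) (hα' i)
  have hn2 := hF.two_le
  by_cases hst : α i = s(v i.castSucc, v i.succ)
  · have hne : v i.castSucc ≠ v i.succ := by
      intro h
      obtain ⟨d, hd, hde⟩ := hα' i
      have h1 : (α i).IsDiag := by rw [hst, h]; simp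
      rw [← hde] at h1
      exact d.adj.ne (Sym2.mk_isDiag_iff.1 h1)
    rw [PlaneEmbedding.eta, if_pos hst]
    refine ⟨PlaneEmbedding.isBlock_edgeGraph hne, fun P hP hPα => ?_⟩
    -- The graph has only two vertices, whereas a path through `α` other than `α` needs a third.
    obtain ⟨z, hz, hz1, hz2⟩ := exists_mem_support_ne hP.1 hP.2.2.1 hPα (v i.castSucc) (v i.succ)
    rcases hP.2.1.1 ((Walk.mem_verts_toSubgraph P).2 hz) with h | h
    exacts [absurd h hz1, absurd h hz2]
  rw [PlaneEmbedding.eta, if_neg hst]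
  refine ⟨hF.isBlock_splitGraph, fun P hP hPα J hJP hJo => ?_⟩
  obtain ⟨hPath, hle, hαP, hatt⟩ := hP
  have hatt2 := (hatt J hJP).2 hJo
  have hsup : ∀ {z}, z ∈ P.support → z ∈ P.toSubgraph.verts :=
    fun h => (Walk.mem_verts_toSubgraph P).2 h
  rcases hJP with ⟨a, b, hab, -, -, -, rfl⟩ | ⟨D, hD, rfl⟩
  · exact ⟨s(a, b), edgeSet_subgraphOfAdj _⟩
  exfalso
  obtain ⟨w, hw, hwP, rfl⟩ := isComponentSet_deleteVerts_iff.1 hD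
  have hα0 : u 0 ∈ P.support := P.snd_mem_support_of_mem_edges (hF.edge_eq ▸ hαP)
  have hα1 : u (n - 1) ∈ P.support := P.fst_mem_support_of_mem_edges (hF.edge_eq ▸ hαP)
  -- The exceptional case: one separator cuts off the whole boundary except `α`.
  by_cases hmax : E.IsMaxSegment (B i) n u (v i.castSucc) (v i.succ) (α i) 0 (n - 1)
  · have hn3 : 3 ≤ n := by
      have := hmax.lt
      omega
    have hle0 : E.OnOuterFace l := PlaneEmbedding.onOuterFace_of_mem hα (Sym2.mem_mk_left _ _)
    have hadj : ∀ a b, a ∈ (B i).verts → a ∉ Set.range u → G.Adj a b → (B i).Adj a b :=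
      fun a b ha hau hab => hF.adj_of_interior hn3 hG.2
        (fun q hq => PlaneEmbedding.onOuterFace_of_mem_arc hQ hle0 hq) (hK.isBlockOf i) ha hau hab
    -- An interior vertex has all its neighbours in `B i`, so it cannot be the only vertex shared
    -- with another block: its neighbour in `B j` would be shared as well.
    have hshared : ∀ (j : Fin (k + 1)) (z : V), z ∈ (B i).verts → z ∈ (B j).verts →
        (∀ w, w ∈ (B i).verts → w ∈ (B j).verts → w = z) → z ∈ Set.range u := by
      intro j z hzi hzj huniq
      by_contra hzu
      obtain ⟨d, hd, -⟩ := hα' j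
      obtain ⟨w, hw⟩ := (hblock j).exists_adj_of_adj (a := d.fst) (b := d.snd) hd.1 hzj
      have := hadj z w hzi hzu ((B j).adj_sub hw)
      exact hw.ne (huniq w ((B i).edge_vert this.symm) ((B j).edge_vert hw.symm)).symm
    have hends : ∀ z, z ∈ Set.range u → z ∈ P.support → z = u 0 ∨ z = u (n - 1) := by
      rintro _ ⟨m, rfl⟩ hm
      have hms := (hle.1 (hsup hm)).2
      rw [← hF.mod m] at hms ⊢
      have hmn := Nat.mod_lt m (show 0 < n by omega)
      by_contra! hcon
      have e0 : m % n ≠ 0 := fun h => hcon.1 (by rw [h])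
      have e1 : m % n ≠ n - 1 := fun h => hcon.2 (by rw [h])
      exact hms (hF.mem_splitVerts_iff.2 ⟨_, _, hmax, hF.linked_segment (by omega) (by omega)
        (by omega) (by omega)⟩)
    have hsu : v i.castSucc ∈ Set.range u := by
      have hsB : v i.castSucc ∈ (B i).verts := (hle.1 (hsup P.start_mem_support)).1
      induction i using Fin.cases with
      | zero =>
        refine hF.mem_range_of_onOuterFace hsB hn3 ?_
        rw [Fin.castSucc_zero, hK.v_zero]
        exact PlaneEmbedding.onOuterFace_of_mem hα (Sym2.mem_mk_right _ _)
      | succ j =>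
        have hint := hK.inter j
        refine hshared j.castSucc _ hsB ?_ fun w h1 h2 => ?_
        · have : v j.succ.castSucc ∈ (B j.castSucc).verts ∩ (B j.succ).verts := hint ▸ rfl
          exact this.1
        · have : w ∈ (B j.castSucc).verts ∩ (B j.succ).verts := ⟨h2, h1⟩
          rwa [hint] at this
    -- The only surviving boundary vertices are the ends of `α`. If both ends of `P` were on the
    -- boundary, `α` would join them, the case already treated.
    have htu : v i.succ ∉ Set.range u := by
      intro htu
      have hne : v i.castSucc ≠ v i.succ := by
        intro h
        have hl0 : P.length ≠ 0 := by
          intro hl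
          rw [← Walk.length_edges, List.length_eq_zero_iff] at hl
          rw [hl] at hαP
          exact absurd hαP List.not_mem_nil
        refine hl0 (hPath.getVert_injOn (by simp) (by simp) ?_)
        rw [Walk.getVert_length, Walk.getVert_zero, h]
      apply hst
      rw [hF.edge_eq]
      rcases hends _ hsu P.start_mem_support with h1 | h1 <;>
        rcases hends _ htu P.end_mem_support with h2 | h2
      · exact absurd (h1.trans h2.symm) hne
      · rw [h1, h2, Sym2.eq_swap]
      · rw [h1, h2]
      · exact absurd (h1.trans h2.symm) hne
    have htP := hle.1 (hsup P.end_mem_support)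
    -- If the block is not the last one, its final vertex is shared with the next block and hence on
    -- the boundary. So the target is `y`, and the indecomposability hypothesis for `y` applies.
    have hty : v i.succ = y := by
      by_contra hty
      apply htu
      have hil : i ≠ Fin.last k := by
        rintro rfl
        exact hty hK.v_last
      obtain ⟨j, rfl⟩ := Fin.exists_castSucc_eq.2 hil
      have hint := hK.inter j
      have hmem : v j.succ.castSucc ∈ (B j.castSucc).verts ∩ (B j.succ).verts := hint ▸ rfl
      refine hshared j.succ _ htP.1 hmem.2 fun w h1 h2 => ?_
      have : w ∈ (B j.castSucc).verts ∩ (B j.succ).verts := ⟨h1, h2⟩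
      rwa [hint] at this
    have hlB : l ∉ (B i).verts := fun h =>
      ((hK.isBlockOf i).prop.1.1 h).2 Q.end_mem_support
    obtain ⟨d, hd, -⟩ := PlaneEmbedding.eq_outer_of_mem_outerEdges_top hα
    have hlr : G.Adj l r := by
      rw [← mem_edgeSet, ← hd]
      exact d.edge_mem
    rcases hF.eq_of_notMem_splitVerts hmax hadj hlr hlB htP.1 htP.2 (hty ▸ hy) hw.1 hw.2 with
      h | h | h
    · exact hwP (hsup (h ▸ P.end_mem_support))
    · exact hwP (hsup (h ▸ hα0))
    · exact hwP (hsup (h ▸ hα1))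
  · rcases hF.ends_notMem_or (s := v i.castSucc) (t := v i.succ) with hN | hdeg
    · obtain ⟨e, heJ, heo⟩ := hJo
      have hmem : ∃ z ∈ e, Linked (E.splitGraph (B i) (v i.castSucc) (v i.succ) (α i))
          P.toSubgraph.verts w z := by
        induction e using Sym2.ind with
        | _ a b =>
          rcases heJ.2 with h | h
          exacts [⟨a, Sym2.mem_mk_left _ _, h⟩, ⟨b, Sym2.mem_mk_right _ _, h⟩]
      obtain ⟨z, hze, hwz⟩ := hmem
      -- An outer edge in the bridge has an internal end, and this end is on `C_B`; the bridge then
      -- has three attachments, too many for an outer bridge of a Tutte path.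
      obtain ⟨m, hm, rfl⟩ := hF.exists_eq_of_mem_etaOuterEdges hst hmax heo hze
      exact (hF.two_lt_ncard_attachments hN hPath hle hαP hPα hw hwP hm hwz).not_ge hatt2
    · rcases hdeg w hw.1 hw.2 with h | h
      · exact hwP (hsup (h ▸ hα0))
      · exact hwP (hsup (h ▸ hα1))
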